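/- **Corollary (principal curvature descriptors from the spherical component).** Let $n\ge 1$, let $\mathcal S\subset\mathbb R^{n+1}$ be a smooth embedded hypersurface, $p\in\mathcal S$, and let $N$ be a smooth unit normal field of $\mathcal S$ near $p$. Let $\kappa_1(p)\le\dots\le\kappa_n(p)$ be the principal curvatures, i.e. the eigenvalues with multiplicity of the Weingarten map $x\mapsto-\bar\nabla_xN$ on $T_p\mathcal S$, let $e_1(p),\dots,e_n(p)$ be an orthonormal basis of corresponding principal directions, and let $H(p)=\sum_{\mu=1}^n\kappa_\mu(p)$. For small $\varepsilon>0$ let $V^+_p(\varepsilon)$ be the connected component of $\{X:\|X-p\|\le\varepsilon\}\setminus\mathcal S$ into which $N(p)$ points, $V_p(\varepsilon)$ its volume, $s$ its barycenter, and $\lambda_1(p,\varepsilon)\ge\dots\ge\lambda_{n+1}(p,\varepsilon)$ the eigenvalues with multiplicity of its covariance matrix $\int_{V^+_p(\varepsilon)}(X-s)(X-s)^T\,dX$, with $e_1(V^+_p(\varepsilon)),\dots,e_{n+1}(V^+_p(\varepsilon))$ any orthonormal basis of corresponding eigenvectors. Let $V_m(\varepsilon)$ be the volume of the ball of radius $\varepsilon$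 in $\mathbb R^m$. Define $$\kappa_\mu(V^+_p(\varepsilon))=\frac{n+4}{\varepsilon^4V_n(\varepsilon)}\Big[\frac{\varepsilon^2V_{n+1}(\varepsilon)}{n+3}-(n+1)\lambda_\mu(p,\varepsilon)+\sum_{\alpha\ne\mu,\,1\le\alpha\le n}\lambda_\alpha(p,\varepsilon)\Big],$$ $$H(V^+_p(\varepsilon))=\frac{(n+2)V_{n+1}(\varepsilon)}{\varepsilon^2V_n(\varepsilon)}\Big(1-2\frac{V_p(\varepsilon)}{V_{n+1}(\varepsilon)}\Big),$$ $$\tilde\kappa_\mu(V^+_p(\varepsilon))=\frac{(n+2)(n+4)}{\varepsilon^4V_n(\varepsilon)}\Big(\frac{\varepsilon^2V_{n+1}(\varepsilon)}{2(n+3)}-\lambda_\mu(p,\varepsilon)\Big)-\frac12H(V^+_p(\varepsilon)).$$ Then there are $C$ and $\varepsilon_0>0$, independent of $\varepsilon$ and of the choice of the eigenvectors, such that for all $0<\varepsilon<\varepsilon_0$ and all $\mu=1,\dots,n$: 1. $|H(p)-H(V^+_p(\varepsilon))|\le C\varepsilon$, $\;|\kappa_\mu(p)-\kappa_\mu(V^+_p(\varepsilon))|\le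 C\varepsilon$ and $|\kappa_\mu(p)-\tilde\kappa_\mu(V^+_p(\varepsilon))|\le C\varepsilon$; 2. $e_\mu(V^+_p(\varepsilon))$ is within $C\varepsilon$ of some unit principal vector $u\in T_p\mathcal S$ for $\kappa_\mu(p)$; in particular, if $\kappa_\mu(p)$ is a simple principal curvature, then $\|\pm e_\mu(V^+_p(\varepsilon))-e_\mu(p)\|\le C\varepsilon$ for a suitable sign; 3. $\|\pm e_{n+1}(V^+_p(\varepsilon))-N(p)\|\le C\varepsilon^2$ for a suitable sign. -/

import Mathlib

open MeasureTheory Topology Filter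
open scoped ContDiff Matrix

namespace CurvatureDescriptors

/-- `S ⊆ ℝⁿ⁺¹` is a smooth (embedded) hypersurface: near each of its points it is the zero set of a
smooth function whose differential does not vanish on `S`. -/
def IsSmoothHypersurface {n : ℕ} (S : Set (EuclideanSpace ℝ (Fin (n + 1)))) : Prop :=
  ∀ q ∈ S, ∃ U : Set (EuclideanSpace ℝ (Fin (n + 1))), IsOpen U ∧ q ∈ U ∧
    ∃ f : EuclideanSpace ℝ (Fin (n + 1)) → ℝ, ContDiffOn ℝ ∞ f U ∧
      (∀ x ∈ U, x ∈ S ↔ f x = 0) ∧ ∀ x ∈ U ∩ S, fderiv ℝ f x ≠ 0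

/-- The tangent space `T_q S`: velocities at `q` of smooth curves in `S` through `q`. -/
def tangentVectors {n : ℕ} (S : Set (EuclideanSpace ℝ (Fin (n + 1))))
    (q : EuclideanSpace ℝ (Fin (n + 1))) : Set (EuclideanSpace ℝ (Fin (n + 1))) :=
  {v | ∃ γ : ℝ → EuclideanSpace ℝ (Fin (n + 1)), ContDiffAt ℝ ∞ γ 0 ∧ γ 0 = q ∧
    (∀ᶠ t in 𝓝 (0 : ℝ), γ t ∈ S) ∧ HasDerivAt γ v 0}

/-- `N` is a smooth unit normal field of `S` near `p`. Smoothness on `S` is expressed through a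
smooth extension to an open subset of the ambient space; off `S` the values of `N` are arbitrary. -/
def IsUnitNormalNear {n : ℕ} (S : Set (EuclideanSpace ℝ (Fin (n + 1))))
    (N : EuclideanSpace ℝ (Fin (n + 1)) → EuclideanSpace ℝ (Fin (n + 1)))
    (p : EuclideanSpace ℝ (Fin (n + 1))) : Prop :=
  ∃ W : Set (EuclideanSpace ℝ (Fin (n + 1))), IsOpen W ∧ p ∈ W ∧ ContDiffOn ℝ ∞ N W ∧
    ∀ q ∈ S ∩ W, ‖N q‖ = 1 ∧ ∀ v ∈ tangentVectors S q, inner ℝ (N q) v = 0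

/-- `u` is a principal vector of `S` at `p` for the value `k`: it is tangent, and the Weingarten map
`u ↦ -D_u N` multiplies it by `k`. -/
def IsPrincipalVector {n : ℕ} (S : Set (EuclideanSpace ℝ (Fin (n + 1))))
    (N : EuclideanSpace ℝ (Fin (n + 1)) → EuclideanSpace ℝ (Fin (n + 1)))
    (p : EuclideanSpace ℝ (Fin (n + 1))) (k : ℝ) (u : EuclideanSpace ℝ (Fin (n + 1))) : Prop :=
  u ∈ tangentVectors S p ∧ -(fderiv ℝ N p u) = k • u

/-- `κ` lists the principal curvatures of `S` at `p` in increasing order (with multiplicity), and `e`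
is an orthonormal frame of corresponding principal directions. -/
def IsPrincipalFrame {n : ℕ} (S : Set (EuclideanSpace ℝ (Fin (n + 1))))
    (N : EuclideanSpace ℝ (Fin (n + 1)) → EuclideanSpace ℝ (Fin (n + 1)))
    (p : EuclideanSpace ℝ (Fin (n + 1))) (κ : Fin n → ℝ)
    (e : Fin n → EuclideanSpace ℝ (Fin (n + 1))) : Prop :=
  Monotone κ ∧ Orthonormal ℝ e ∧ ∀ μ, IsPrincipalVector S N p (κ μ) (e μ)

/-- The spherical component `V⁺_p(ε)`: the connected component of the ball of radius `ε` about `p`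
minus `S` into which the vector `ν`, attached at `p`, points. -/
def sphericalComponent {n : ℕ} (S : Set (EuclideanSpace ℝ (Fin (n + 1))))
    (p ν : EuclideanSpace ℝ (Fin (n + 1))) (ε : ℝ) : Set (EuclideanSpace ℝ (Fin (n + 1))) :=
  {x | ∀ᶠ t in 𝓝[>] (0 : ℝ), p + t • ν ∈ connectedComponentIn (Metric.closedBall p ε \ S) x}

/-- The volume `V(D)`. -/
noncomputable def vol {m : ℕ} (D : Set (EuclideanSpace ℝ (Fin m))) : ℝ :=
  (volume D).toReal

/-- The barycenter `s(D)`. -/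
noncomputable def barycenter {m : ℕ} (D : Set (EuclideanSpace ℝ (Fin m))) :
    EuclideanSpace ℝ (Fin m) :=
  (vol D)⁻¹ • ∫ x in D, x

/-- The covariance matrix `C(D) = ∫_D (X - s(D)) ⊗ (X - s(D))ᵀ`, not normalized by the volume. -/
noncomputable def covMatrix {m : ℕ} (D : Set (EuclideanSpace ℝ (Fin m))) :
    Matrix (Fin m) (Fin m) ℝ :=
  Matrix.of fun i j => ∫ x in D, (x i - barycenter D i) * (x j - barycenter D j)

/-- `lam` lists the eigenvalues of `A` in decreasing order (with multiplicity), and `b` is an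
orthonormal basis of corresponding eigenvectors. -/
def IsEigenDecomposition {m : ℕ} (A : Matrix (Fin m) (Fin m) ℝ) (lam : Fin m → ℝ)
    (b : OrthonormalBasis (Fin m) ℝ (EuclideanSpace ℝ (Fin m))) : Prop :=
  Antitone lam ∧ ∀ i, A *ᵥ (b i).ofLp = lam i • (b i).ofLp

/-- `V_m(ε)`, the volume of the ball of radius `ε` in `ℝᵐ`. -/
noncomputable def ballVol (m : ℕ) (ε : ℝ) : ℝ :=
  vol (Metric.closedBall (0 : EuclideanSpace ℝ (Fin m)) ε)

/-- The descriptor of the mean curvature at scale `ε`, in terms of the volume `v`. -/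
noncomputable def meanCurvDescriptor (n : ℕ) (ε v : ℝ) : ℝ :=
  (n + 2) * ballVol (n + 1) ε / (ε ^ 2 * ballVol n ε) * (1 - 2 * (v / ballVol (n + 1) ε))

/-- The descriptor of the `μ`-th principal curvature at scale `ε`, in terms of the first `n`
eigenvalues. -/
noncomputable def curvDescriptor (n : ℕ) (ε : ℝ) (lam : Fin (n + 1) → ℝ) (μ : Fin n) : ℝ :=
  (n + 4) / (ε ^ 4 * ballVol n ε) *
    (ε ^ 2 * ballVol (n + 1) ε / (n + 3) - (n + 1) * lam μ.castSucc
      + ∑ α ∈ Finset.univ.erase μ, lam (Fin.castSucc α))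

/-- The descriptor of the `μ`-th principal curvature at scale `ε`, in terms of the `μ`-th eigenvalue
and the volume `v`. -/
noncomputable def curvDescriptorVol (n : ℕ) (ε v : ℝ) (lam : Fin (n + 1) → ℝ) (μ : Fin n) : ℝ :=
  (n + 2) * (n + 4) / (ε ^ 4 * ballVol n ε) *
    (ε ^ 2 * ballVol (n + 1) ε / (2 * (n + 3)) - lam μ.castSucc)
      - 1 / 2 * meanCurvDescriptor n ε v

end CurvatureDescriptors

/-!
# Principal curvatures from the covariance of the spherical component

Let `B = (e₁, …, eₙ, N p)`, an orthonormal basis, and rescale by `X = p + ε R Y`, where `R` carries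
the standard basis to `B`. A defining function `f` of `S`, normalized so that its gradient at `p` is
`N p`, has Hessian `-κ_μ δ_{μν}` on the principal directions: this follows by differentiating along
`S` the relation that tangent vectors are orthogonal to `N`. Hence, with `q y = ½ ∑ κ_μ y_μ²`,

  `f (p + ε R Y) / ε = Y_{n+1} - ε q y + O(ε |Y_{n+1}|) + O(ε²)`,

where `y` is the horizontal part of `Y`. For small `ε` the set `{f > 0}` in the ball is star-shaped
about `p + ε N p`, so it is the spherical component, and in the coordinates `Y` it is the part of the
unit ball above the paraboloid `ε q` up to a layer of thickness `O(ε²)`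
(`exists_sphericalComponent_normal_form`). No parametrization of `S` as a graph is needed.

For a function `ψ` on the ball, comparison with the upper half ball gives
`∫_D ψ = ∫_{half ball} ψ - ε ∫_{disk} q ψ + O(ε²)` (`abs_integral_sub_add_le`). Applied to the
monomials of degree at most two, with the second and fourth moments of the ball and the vanishing of
odd moments, this shows that the covariance matrix of `D` is diagonal up to `O(ε²)`
(`exists_covMatrix_cap`): with `V` and `W` the volumes of the unit balls of dimensions `n` and
`n + 1`, the tangential entries are
`W / (2 (n + 3)) - ε V / (2 (n + 2) (n + 4)) (H + 2 κ_μ)`, while the displacement of the barycenter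
in the normal direction makes the last entry smaller by a fixed amount.

Matrix perturbation does the rest. The sorted eigenvalues differ from the diagonal entries by
`O(ε²)` (`abs_eigenvalue_sub_le`), and solving for the curvatures divides by `ε`. The component of an
eigenvector along a coordinate direction is `O(ε²)` divided by the gap between the two diagonal
entries (`abs_sub_mul_abs_eigenvector_le`). That gap is of order one between normal and tangential
directions, which gives the error `O(ε²)` for the normal, and of order `ε` between principal
directions of different curvatures, which gives `O(ε)` for those.
-/

namespace CurvatureDescriptors

/-! ### Tangent vectors and the Hessian of a defining function -/

/-- A vector in the kernel of the differential is the velocity of a smooth curve in the zero set. The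
curve is the image of a line under the local inverse of a map straightening the zero set. -/
theorem exists_curve_of_fderiv_eq_zero {E : Type*} [NormedAddCommGroup E] [NormedSpace ℝ E]
    [CompleteSpace E] {f : E → ℝ} {q v : E} (hf : ContDiffAt ℝ ∞ f q) (hq : f q = 0)
    (hd : fderiv ℝ f q ≠ 0) (hv : fderiv ℝ f q v = 0) :
    ∃ γ : ℝ → E, ContDiffAt ℝ ∞ γ 0 ∧ γ 0 = q ∧ (∀ᶠ t in 𝓝 (0 : ℝ), f (γ t) = 0) ∧
      HasDerivAt γ v 0 := by
  obtain ⟨w, hw⟩ : ∃ w, fderiv ℝ f q w = 1 := by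
    obtain ⟨w, hw⟩ : ∃ w, fderiv ℝ f q w ≠ 0 := by
      by_contra! h
      exact hd (ContinuousLinearMap.ext h)
    exact ⟨(fderiv ℝ f q w)⁻¹ • w, by simp [hw]⟩
  -- `Φ` straightens `S`: the value of the linear form `fderiv ℝ f q` at `Φ x - q` is `f x`.
  let Φ : E → E := fun x => x + (f x - fderiv ℝ f q (x - q)) • w
  have hΦ : ContDiffAt ℝ ∞ Φ q := by
    refine contDiffAt_id.add ((hf.sub ?_).smul contDiffAt_const)
    exact (fderiv ℝ f q).contDiff.contDiffAt.comp q (contDiffAt_id.sub contDiffAt_const)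
  have hΦ' : HasFDerivAt Φ ((ContinuousLinearEquiv.refl ℝ E : E ≃L[ℝ] E) : E →L[ℝ] E) q := by
    have h1 : HasFDerivAt f (fderiv ℝ f q) q := (hf.differentiableAt (by simp)).hasFDerivAt
    have h2 : HasFDerivAt (fun x => fderiv ℝ f q (x - q)) (fderiv ℝ f q) q :=
      (fderiv ℝ f q).hasFDerivAt.comp q ((hasFDerivAt_id q).sub_const q)
    have h3 := (hasFDerivAt_id q).add ((h1.sub h2).smul_const w)
    convert! h3 using 1
    ext x
    simp
  have hqΦ : Φ q = q := by simp [Φ, hq]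
  let Ψ := hΦ.localInverse hΦ' (by simp)
  have hΨ : ContDiffAt ℝ ∞ Ψ q := by
    simpa only [hqΦ] using hΦ.to_localInverse hΦ' (by simp)
  have hΨq : Ψ q = q := by
    simpa only [hqΦ] using hΦ.localInverse_apply_image hΦ' (by simp)
  have hstrict := hΦ.hasStrictFDerivAt' hΦ' (by simp)
  have hΨ' : HasFDerivAt Ψ (ContinuousLinearMap.id ℝ E) q := by
    simpa only [hqΦ] using! hstrict.to_localInverse.hasFDerivAt
  have hr : ∀ᶠ y in 𝓝 q, Φ (Ψ y) = y := by
    simpa only [hqΦ] using! hstrict.eventually_right_inverse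
  have hline : HasDerivAt (fun t : ℝ => q + t • v) v 0 := by
    simpa using ((hasDerivAt_id (0 : ℝ)).smul_const v).const_add q
  have hline0 : q + (0 : ℝ) • v = q := by simp
  refine ⟨fun t => Ψ (q + t • v), ?_, by simp [hΨq], ?_, ?_⟩
  · refine ContDiffAt.comp (0 : ℝ) (by rw [hline0]; exact hΨ) ?_
    exact contDiffAt_const.add (contDiffAt_id.smul contDiffAt_const)
  · have ht : Tendsto (fun t : ℝ => q + t • v) (𝓝 0) (𝓝 q) := by
      simpa only [hline0, zero_smul, add_zero] using hline.continuousAt.tendsto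
    filter_upwards [ht.eventually hr] with t ht
    have h4 := congrArg (fun y => fderiv ℝ f q (y - q)) ht
    simp only [Φ, map_sub, map_add, map_smul, hw, hv, smul_eq_mul] at h4
    linarith
  · have h := HasFDerivAt.comp_hasDerivAt (0 : ℝ) (by rw [hline0]; exact hΨ') hline
    simpa using! h

section Tangent

variable {n : ℕ} {S U : Set (EuclideanSpace ℝ (Fin (n + 1)))}
  {f : EuclideanSpace ℝ (Fin (n + 1)) → ℝ}
  {q v p u : EuclideanSpace ℝ (Fin (n + 1))}

theorem mem_tangentVectors_of_fderiv_eq_zero (hU : IsOpen U) (hqU : q ∈ U) (hqS : q ∈ S)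
    (hf : ContDiffOn ℝ ∞ f U) (hfS : ∀ x ∈ U, x ∈ S ↔ f x = 0) (hd : fderiv ℝ f q ≠ 0)
    (hv : fderiv ℝ f q v = 0) : v ∈ tangentVectors S q := by
  obtain ⟨γ, h1, h2, h3, h4⟩ := exists_curve_of_fderiv_eq_zero
    (hf.contDiffAt (hU.mem_nhds hqU)) ((hfS q hqU).1 hqS) hd hv
  refine ⟨γ, h1, h2, ?_, h4⟩
  have hc : Tendsto γ (𝓝 0) (𝓝 q) := h2 ▸ h4.continuousAt.tendsto
  filter_upwards [h3, hc.eventually (hU.mem_nhds hqU)] with t ht htU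
  exact (hfS _ htU).2 ht

theorem fderiv_eq_zero_of_mem_tangentVectors (hU : IsOpen U) (hqU : q ∈ U)
    (hf : ContDiffOn ℝ ∞ f U) (hfS : ∀ x ∈ U, x ∈ S ↔ f x = 0)
    (hv : v ∈ tangentVectors S q) : fderiv ℝ f q v = 0 := by
  obtain ⟨γ, h1, h2, h3, h4⟩ := hv
  have hc : Tendsto γ (𝓝 0) (𝓝 q) := h2 ▸ h4.continuousAt.tendsto
  have hfq : HasFDerivAt f (fderiv ℝ f q) (γ 0) := by
    rw [h2]
    exact ((hf.contDiffAt (hU.mem_nhds hqU)).differentiableAt (by simp)).hasFDerivAt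
  have h5 : HasDerivAt (f ∘ γ) (fderiv ℝ f q v) 0 := hfq.comp_hasDerivAt 0 h4
  have h6 : f ∘ γ =ᶠ[𝓝 0] fun _ => (0 : ℝ) := by
    filter_upwards [h3, hc.eventually (hU.mem_nhds hqU)] with t ht htU
    exact (hfS _ htU).1 ht
  exact h5.unique ((hasDerivAt_const (0 : ℝ) (0 : ℝ)).congr_of_eventuallyEq h6)

/-- The derivative of the normal field is, up to normalization, the Hessian of a defining function:
differentiate the relation expressing that the tangent vectors
`f'(q)(N p) • v - f'(q) v • N p` are orthogonal to `N q` along `S`. -/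
theorem inner_fderiv_normal_eq {N : EuclideanSpace ℝ (Fin (n + 1)) → EuclideanSpace ℝ (Fin (n + 1))}
    (hU : IsOpen U) (hpU : p ∈ U)
    (hf : ContDiffOn ℝ ∞ f U) (hfS : ∀ x ∈ U, x ∈ S ↔ f x = 0)
    (hd : ∀ x ∈ U ∩ S, fderiv ℝ f x ≠ 0) (hp : p ∈ S)
    (hN : IsUnitNormalNear S N p) (hfN : fderiv ℝ f p (N p) = 1)
    (hu : u ∈ tangentVectors S p) (hv : v ∈ tangentVectors S p) :
    inner ℝ (fderiv ℝ N p u) v = fderiv ℝ (fderiv ℝ f) p u v := by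
  obtain ⟨W, hW, hpW, hNW, hNS⟩ := hN
  have hfv := fderiv_eq_zero_of_mem_tangentVectors hU hpU hf hfS hv
  have hNv : inner ℝ (N p) v = 0 := (hNS p ⟨hp, hpW⟩).2 v hv
  have hNN : ‖N p‖ = 1 := (hNS p ⟨hp, hpW⟩).1
  obtain ⟨γ, h1, h2, h3, h4⟩ := hu
  have hc : Tendsto γ (𝓝 0) (𝓝 p) := h2 ▸ h4.continuousAt.tendsto
  have hN1 : HasDerivAt (fun t => N (γ t)) (fderiv ℝ N p u) 0 := by
    refine HasFDerivAt.comp_hasDerivAt (0 : ℝ) ?_ h4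
    rw [h2]
    exact ((hNW.contDiffAt (hW.mem_nhds hpW)).differentiableAt (by simp)).hasFDerivAt
  have hf1 : HasDerivAt (fun t => fderiv ℝ f (γ t)) (fderiv ℝ (fderiv ℝ f) p u) 0 := by
    refine HasFDerivAt.comp_hasDerivAt (0 : ℝ) ?_ h4
    rw [h2]
    have : ContDiffAt ℝ 1 (fderiv ℝ f) p :=
      (hf.contDiffAt (hU.mem_nhds hpU)).fderiv_right (by norm_cast)
    exact (this.differentiableAt (by simp)).hasFDerivAt
  have hNv1 := hN1.inner ℝ (hasDerivAt_const (0 : ℝ) v)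
  have hNN1 := hN1.inner ℝ (hasDerivAt_const (0 : ℝ) (N p))
  have hfv1 := hf1.clm_apply (hasDerivAt_const (0 : ℝ) v)
  have hfN1 := hf1.clm_apply (hasDerivAt_const (0 : ℝ) (N p))
  have hG := (hfN1.mul hNv1).sub (hfv1.mul hNN1)
  have h0 : (fun t => fderiv ℝ f (γ t) (N p) * inner ℝ (N (γ t)) v
      - fderiv ℝ f (γ t) v * inner ℝ (N (γ t)) (N p)) =ᶠ[𝓝 0] fun _ => (0 : ℝ) := by
    filter_upwards [h3, hc.eventually (hU.mem_nhds hpU), hc.eventually (hW.mem_nhds hpW)]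
      with t ht htU htW
    have ht1 : fderiv ℝ f (γ t) (N p) • v - fderiv ℝ f (γ t) v • N p ∈ tangentVectors S (γ t) := by
      refine mem_tangentVectors_of_fderiv_eq_zero hU htU ht hf hfS (hd _ ⟨htU, ht⟩) ?_
      simp [mul_comm]
    have := (hNS _ ⟨ht, htW⟩).2 _ ht1
    simpa [inner_sub_right, inner_smul_right] using this
  have h5 := hG.unique ((hasDerivAt_const (0 : ℝ) (0 : ℝ)).congr_of_eventuallyEq h0)
  simp [h2, hfN, hfv, hNv, hNN] at h5
  linarith

end Tangent

/-! ### Taylor estimates -/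

section Taylor

variable {E F : Type*} [NormedAddCommGroup E] [NormedSpace ℝ E] [NormedAddCommGroup F]
  [NormedSpace ℝ F]

theorem exists_norm_sub_sub_fderiv_le {f : E → F} {p : E} (hf : ContDiffAt ℝ 2 f p) :
    ∃ M r : ℝ, 0 ≤ M ∧ 0 < r ∧ (∀ x ∈ Metric.ball p r, DifferentiableAt ℝ f x) ∧
      ∀ x ∈ Metric.ball p r, ∀ y ∈ Metric.ball p r,
        ‖f y - f x - fderiv ℝ f x (y - x)‖ ≤ M * ‖y - x‖ ^ 2 := by
  have h1 : ContDiffAt ℝ 1 (fderiv ℝ f) p := hf.fderiv_right (by norm_num)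
  obtain ⟨K, t, ht, hK⟩ := h1.exists_lipschitzOnWith
  have h2 : ∀ᶠ x in 𝓝 p, DifferentiableAt ℝ f x := by
    filter_upwards [hf.eventually (by simp)] with x hx
    exact hx.differentiableAt (by simp)
  obtain ⟨r, hr, hball⟩ := Metric.mem_nhds_iff.1 (inter_mem ht h2)
  refine ⟨K, r, K.2, hr, fun x hx => (hball hx).2, fun x hx y hy => ?_⟩
  have hseg : segment ℝ x y ⊆ Metric.ball p r := (convex_ball p r).segment_subset hx hy
  have := (convex_segment x y).norm_image_sub_le_of_norm_fderiv_le' (𝕜 := ℝ) (f := f)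
    (C := K * ‖y - x‖) (φ := fderiv ℝ f x) (fun z hz => (hball (hseg hz)).2) ?_
    (left_mem_segment ℝ x y) (right_mem_segment ℝ x y)
  · calc _ ≤ _ := this
      _ = _ := by ring
  · intro z hz
    have h3 := hK.dist_le_mul z (hball (hseg hz)).1 x (hball hx).1
    rw [dist_eq_norm, dist_eq_norm] at h3
    refine h3.trans (mul_le_mul_of_nonneg_left ?_ K.2)
    rw [segment_eq_image'] at hz
    obtain ⟨s, hs, rfl⟩ := hz
    rw [add_sub_cancel_left, norm_smul, Real.norm_of_nonneg hs.1]
    exact mul_le_of_le_one_left (norm_nonneg _) hs.2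

/-- Second order Taylor expansion with cubic remainder: the first order expansion of the derivative,
integrated along segments by the mean value inequality. -/
theorem exists_abs_sub_taylor_two_le {f : E → ℝ} {p : E} (hf : ContDiffAt ℝ 3 f p) :
    ∃ M r : ℝ, 0 ≤ M ∧ 0 < r ∧ ∀ x, ‖x‖ < r →
      |f (p + x) - f p - fderiv ℝ f p x - 1 / 2 * fderiv ℝ (fderiv ℝ f) p x x|
        ≤ M * ‖x‖ ^ 3 := by
  have h1 : ContDiffAt ℝ 2 (fderiv ℝ f) p := hf.fderiv_right (by norm_num)
  obtain ⟨M, r, hM, hr, hd', hb⟩ := exists_norm_sub_sub_fderiv_le h1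
  obtain ⟨-, r', -, hr', hd, -⟩ := exists_norm_sub_sub_fderiv_le (hf.of_le (by norm_num))
  have hp : p ∈ Metric.ball p r := Metric.mem_ball_self hr
  have hsymm : ∀ x y, fderiv ℝ (fderiv ℝ f) p x y = fderiv ℝ (fderiv ℝ f) p y x :=
    fun x y => hf.isSymmSndFDerivAt (by simp; norm_num) x y
  refine ⟨M, min r r', hM, lt_min hr hr', fun x hx => ?_⟩
  set D := fderiv ℝ (fderiv ℝ f) p with hD
  let g : E → ℝ := fun z => f z - 1 / 2 * D (z - p) (z - p)
  have hg : ∀ z ∈ Metric.ball p (min r r'),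
      HasFDerivAt g (fderiv ℝ f z - D (z - p)) z := by
    intro z hz
    have hz' : z ∈ Metric.ball p r' := Metric.ball_subset_ball (min_le_right _ _) hz
    have h2 : HasFDerivAt (fun z => D (z - p)) D z :=
      D.hasFDerivAt.comp z ((hasFDerivAt_id z).sub_const p)
    have h3 := (h2.clm_apply ((hasFDerivAt_id z).sub_const p)).const_mul (1 / 2 : ℝ)
    convert! (hd z hz').hasFDerivAt.sub h3 using 1
    ext w
    simp [hsymm w]
    ring
  have hball : ∀ z ∈ segment ℝ p (p + x), z ∈ Metric.ball p (min r r') ∧ ‖z - p‖ ≤ ‖x‖ := by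
    intro z hz
    rw [segment_eq_image'] at hz
    obtain ⟨s, hs, rfl⟩ := hz
    have h4 : ‖p + s • (p + x - p) - p‖ ≤ ‖x‖ := by
      rw [add_sub_cancel_left, add_sub_cancel_left, norm_smul, Real.norm_of_nonneg hs.1]
      exact mul_le_of_le_one_left (norm_nonneg _) hs.2
    exact ⟨by rw [mem_ball_iff_norm]; exact h4.trans_lt hx, h4⟩
  have := (convex_segment p (p + x)).norm_image_sub_le_of_norm_fderiv_le' (𝕜 := ℝ) (f := g)
    (C := M * ‖x‖ ^ 2) (φ := fderiv ℝ f p)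
    (fun z hz => (hg z (hball z hz).1).differentiableAt) ?_
    (left_mem_segment ℝ p (p + x)) (right_mem_segment ℝ p (p + x))
  · simp only [g, add_sub_cancel_left, sub_self, map_zero, mul_zero, sub_zero,
      Real.norm_eq_abs] at this
    calc _ = |f (p + x) - 1 / 2 * D x x - f p - fderiv ℝ f p x| := by ring_nf
      _ ≤ _ := this
      _ = _ := by ring
  · intro z hz
    rw [(hg z (hball z hz).1).fderiv, sub_right_comm]
    refine (hb p hp z (Metric.ball_subset_ball (min_le_left _ _) (hball z hz).1)).trans ?_
    gcongr
    exact (hball z hz).2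

/-- A function with Lipschitz derivative is concave up to a quadratic error. -/
theorem exists_convexComb_le_add {f : E → ℝ} {p : E} (hf : ContDiffAt ℝ 2 f p) :
    ∃ M r : ℝ, 0 ≤ M ∧ 0 < r ∧ (∀ x ∈ Metric.ball p r, |f x - f p - fderiv ℝ f p (x - p)|
        ≤ M * ‖x - p‖ ^ 2) ∧
      ∀ x ∈ Metric.ball p r, ∀ y ∈ Metric.ball p r, ∀ s ∈ Set.Icc (0 : ℝ) 1,
        (1 - s) * f x + s * f y ≤ f ((1 - s) • x + s • y) + M * s * ‖x - y‖ ^ 2 := by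
  obtain ⟨M, r, hM, hr, -, hb⟩ := exists_norm_sub_sub_fderiv_le hf
  refine ⟨M, r, hM, hr, fun x hx => hb p (Metric.mem_ball_self hr) x hx,
    fun x hx y hy s hs => ?_⟩
  set z := (1 - s) • x + s • y with hz
  have hzb : z ∈ Metric.ball p r :=
    (convex_ball p r) hx hy (sub_nonneg.2 hs.2) hs.1 (by ring)
  have h1 := (abs_le.1 (hb z hzb x hx)).2
  have h2 := (abs_le.1 (hb z hzb y hy)).2
  have e1 : x - z = s • (x - y) := by rw [hz]; module
  have e2 : y - z = -(1 - s) • (x - y) := by rw [hz]; module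
  rw [e1, norm_smul, map_smul, Real.norm_of_nonneg hs.1, smul_eq_mul] at h1
  rw [e2, norm_smul, map_smul, norm_neg, Real.norm_of_nonneg (sub_nonneg.2 hs.2),
    smul_eq_mul] at h2
  have h3 := mul_le_mul_of_nonneg_left h1 (sub_nonneg.2 hs.2)
  have h4 := mul_le_mul_of_nonneg_left h2 hs.1
  have h5 : 0 ≤ M * s ^ 2 * ‖x - y‖ ^ 2 := by positivity
  have e3 : (1 - s) * (M * (s * ‖x - y‖) ^ 2) + s * (M * ((1 - s) * ‖x - y‖) ^ 2)
      = M * s * ‖x - y‖ ^ 2 - M * s ^ 2 * ‖x - y‖ ^ 2 := by ring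
  linarith

end Taylor

/-- For small `ε` the spherical component is the part of the ball on which the defining function is
positive: that part is star-shaped about `p + ε ν`, hence connected. -/
theorem exists_sphericalComponent_eq {n : ℕ} {S U : Set (EuclideanSpace ℝ (Fin (n + 1)))}
    {f : EuclideanSpace ℝ (Fin (n + 1)) → ℝ} {p ν : EuclideanSpace ℝ (Fin (n + 1))}
    (hU : IsOpen U) (hpU : p ∈ U) (hf : ContDiffOn ℝ ∞ f U) (hfS : ∀ x ∈ U, x ∈ S ↔ f x = 0)
    (hp : p ∈ S) (hν : ‖ν‖ = 1) (hfν : fderiv ℝ f p ν = 1) :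
    ∃ ε₀ : ℝ, 0 < ε₀ ∧ ∀ ε, 0 < ε → ε < ε₀ → Metric.closedBall p ε ⊆ U ∧
      sphericalComponent S p ν ε = {x ∈ Metric.closedBall p ε | 0 < f x} := by
  have hfp : f p = 0 := (hfS p hpU).1 hp
  obtain ⟨M, r, hM, hr, h1, h2⟩ :=
    exists_convexComb_le_add ((hf.contDiffAt (hU.mem_nhds hpU)).of_le (by norm_cast))
  obtain ⟨r', hr', hrU⟩ := Metric.mem_nhds_iff.1 (hU.mem_nhds hpU)
  refine ⟨min (min r r') (1 / (5 * M + 1)), by positivity, fun ε hε hεlt => ?_⟩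
  have hεr : ε < r := hεlt.trans_le ((min_le_left _ _).trans (min_le_left _ _))
  have hεr' : ε < r' := hεlt.trans_le ((min_le_left _ _).trans (min_le_right _ _))
  have hεM : 5 * M * ε < 1 := by
    have := hεlt.trans_le (min_le_right _ _)
    rw [lt_div_iff₀ (by positivity)] at this
    linarith
  have hBr : Metric.closedBall p ε ⊆ Metric.ball p r := Metric.closedBall_subset_ball hεr
  have hBU : Metric.closedBall p ε ⊆ U := (Metric.closedBall_subset_ball hεr').trans hrU
  refine ⟨hBU, ?_⟩
  set R := {x ∈ Metric.closedBall p ε | 0 < f x} with hR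
  have hline : ∀ t, 0 < t → t ≤ ε → p + t • ν ∈ Metric.closedBall p ε ∧
      t - M * t ^ 2 ≤ f (p + t • ν) := by
    intro t ht htε
    have hmem : p + t • ν ∈ Metric.closedBall p ε := by
      rw [mem_closedBall_iff_norm]
      simpa [norm_smul, hν, abs_of_pos ht] using htε
    refine ⟨hmem, ?_⟩
    have := (abs_le.1 (h1 _ (hBr hmem))).1
    simp only [add_sub_cancel_left, map_smul, hfν, hfp, norm_smul, hν, mul_one,
      Real.norm_of_nonneg ht.le, smul_eq_mul, sub_zero] at this
    linarith
  have hlineR : ∀ t, 0 < t → t ≤ ε → p + t • ν ∈ R := by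
    intro t ht htε
    refine ⟨(hline t ht htε).1, lt_of_lt_of_le ?_ (hline t ht htε).2⟩
    have : M * t ≤ M * ε := by gcongr
    nlinarith [mul_nonneg hM hε.le]
  have hq := hlineR ε hε le_rfl
  have hstar : StarConvex ℝ (p + ε • ν) R := by
    rw [starConvex_iff_segment_subset]
    intro x hx z hz
    rw [segment_symm, segment_eq_image] at hz
    obtain ⟨s, hs, rfl⟩ := hz
    refine ⟨(convex_closedBall p ε) hx.1 hq.1 (sub_nonneg.2 hs.2) hs.1 (by ring), ?_⟩
    have h3 := h2 x (hBr hx.1) _ (hBr hq.1) s hs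
    have h4 : ‖x - (p + ε • ν)‖ ≤ 2 * ε := by
      have ha := mem_closedBall_iff_norm.1 hx.1
      have hb := mem_closedBall_iff_norm.1 hq.1
      calc ‖x - (p + ε • ν)‖ = ‖(x - p) - (p + ε • ν - p)‖ := by congr 1; abel
        _ ≤ ‖x - p‖ + ‖p + ε • ν - p‖ := norm_sub_le _ _
        _ ≤ 2 * ε := by linarith
    have h5 : M * s * ‖x - (p + ε • ν)‖ ^ 2 ≤ M * s * (2 * ε) ^ 2 := by
      have := hs.1
      gcongr
    have h6 := mul_le_mul_of_nonneg_left (hline ε hε le_rfl).2 hs.1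
    rcases hs.1.eq_or_lt with h0 | h0
    · have hx0 := hx.2
      simpa [← h0] using hx0
    · have h7 : 0 ≤ (1 - s) * f x := mul_nonneg (sub_nonneg.2 hs.2) hx.2.le
      have h8 : 0 < s * ε * (1 - 5 * M * ε) := mul_pos (mul_pos h0 hε) (by linarith)
      have h9 : s * (ε - M * ε ^ 2) - M * s * (2 * ε) ^ 2 = s * ε * (1 - 5 * M * ε) := by ring
      linarith
  have hRconn : IsPreconnected R := (hstar.isPathConnected hq).isConnected.isPreconnected
  have hRA : R ⊆ Metric.closedBall p ε \ S := fun x hx =>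
    ⟨hx.1, fun hxS => hx.2.ne' ((hfS x (hBU hx.1)).1 hxS)⟩
  have hsmall : ∀ᶠ t in 𝓝[>] (0 : ℝ), p + t • ν ∈ R := by
    filter_upwards [Ioc_mem_nhdsGT hε] with t ht
    exact hlineR t ht.1 ht.2
  ext x
  constructor
  · intro hx
    have hx' : ∀ᶠ t in 𝓝[>] (0 : ℝ), p + t • ν ∈
      connectedComponentIn (Metric.closedBall p ε \ S) x := hx
    obtain ⟨t, htx, htR⟩ := (hx'.and hsmall).exists
    have hxA : x ∈ Metric.closedBall p ε \ S :=
      connectedComponentIn_nonempty_iff.1 ⟨_, htx⟩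
    have hop : IsOpen (U ∩ f ⁻¹' Set.Ioi 0) := hf.continuousOn.isOpen_inter_preimage hU isOpen_Ioi
    have hon : IsOpen (U ∩ f ⁻¹' Set.Iio 0) := hf.continuousOn.isOpen_inter_preimage hU isOpen_Iio
    -- A connected subset of the ball off `S` on which `f > 0` somewhere lies in `{f > 0}`.
    have hsub := (isPreconnected_connectedComponentIn
      (x := x) (F := Metric.closedBall p ε \ S)).subset_left_of_subset_union hop hon
      (Set.disjoint_left.2 fun y hy hy' => lt_asymm (a := 0) (b := f y) hy.2 hy'.2)
      (fun y hy => by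
        have hyA := connectedComponentIn_subset _ _ hy
        have hy0 : f y ≠ 0 := fun h => hyA.2 ((hfS y (hBU hyA.1)).2 h)
        rcases hy0.lt_or_gt with h | h
        · exact Or.inr ⟨hBU hyA.1, h⟩
        · exact Or.inl ⟨hBU hyA.1, h⟩)
      ⟨_, htx, hBU htR.1, htR.2⟩
    exact ⟨hxA.1, (hsub (mem_connectedComponentIn hxA)).2⟩
  · intro hx
    have hsub := hRconn.subset_connectedComponentIn hx hRA
    exact hsmall.mono fun t ht => hsub ht

/-! ### The normal form of the spherical component -/

section NormalForm

variable {n : ℕ} {S : Set (EuclideanSpace ℝ (Fin (n + 1)))}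
  {N : EuclideanSpace ℝ (Fin (n + 1)) → EuclideanSpace ℝ (Fin (n + 1))}
  {p : EuclideanSpace ℝ (Fin (n + 1))} {κ : Fin n → ℝ}
  {e : Fin n → EuclideanSpace ℝ (Fin (n + 1))}

/-- The principal directions and the normal form an orthonormal basis, the normal being last. -/
theorem exists_orthonormalBasis_of_isPrincipalFrame (hp : p ∈ S) (hN : IsUnitNormalNear S N p)
    (he : IsPrincipalFrame S N p κ e) :
    ∃ B : OrthonormalBasis (Fin (n + 1)) ℝ (EuclideanSpace ℝ (Fin (n + 1))),
      (∀ μ : Fin n, B μ.castSucc = e μ) ∧ B (Fin.last n) = N p := by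
  obtain ⟨W, -, hpW, -, hNS⟩ := hN
  have hNe : ∀ μ, inner ℝ (N p) (e μ) = 0 := fun μ => (hNS p ⟨hp, hpW⟩).2 _ (he.2.2 μ).1
  have hNN := (hNS p ⟨hp, hpW⟩).1
  have hon : Orthonormal ℝ (Fin.snoc e (N p) : Fin (n + 1) → EuclideanSpace ℝ (Fin (n + 1))) := by
    constructor
    · intro i
      induction i using Fin.lastCases with
      | last => simpa using hNN
      | cast i => simpa using he.2.1.1 i
    · intro i j hij
      induction i using Fin.lastCases with
      | last =>
        induction j using Fin.lastCases with
        | last => exact absurd rfl hij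
        | cast j => simpa using hNe j
      | cast i =>
        induction j using Fin.lastCases with
        | last => simpa [real_inner_comm] using hNe i
        | cast j => simpa using he.2.1.2 (fun h => hij (by rw [h]))
  let b := basisOfOrthonormalOfCardEqFinrank hon (by simp)
  have hb : ⇑b = Fin.snoc e (N p) := coe_basisOfOrthonormalOfCardEqFinrank hon (by simp)
  refine ⟨b.toOrthonormalBasis (by rwa [hb]), fun μ => ?_, ?_⟩
  · simp [hb]
  · simp [hb]

/-- A defining function whose gradient at `p` is the unit normal. -/
theorem exists_defining_function (hS : IsSmoothHypersurface S) (hp : p ∈ S)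
    (B : OrthonormalBasis (Fin (n + 1)) ℝ (EuclideanSpace ℝ (Fin (n + 1))))
    (hB : ∀ μ : Fin n, B μ.castSucc ∈ tangentVectors S p) :
    ∃ U : Set (EuclideanSpace ℝ (Fin (n + 1))), IsOpen U ∧ p ∈ U ∧
      ∃ f : EuclideanSpace ℝ (Fin (n + 1)) → ℝ, ContDiffOn ℝ ∞ f U ∧
        (∀ x ∈ U, x ∈ S ↔ f x = 0) ∧ (∀ x ∈ U ∩ S, fderiv ℝ f x ≠ 0) ∧
        ∀ x, fderiv ℝ f p x = inner ℝ (B (Fin.last n)) x := by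
  obtain ⟨U, hU, hpU, f, hf, hfS, hd⟩ := hS p hp
  have hfB : ∀ μ : Fin n, fderiv ℝ f p (B μ.castSucc) = 0 := fun μ =>
    fderiv_eq_zero_of_mem_tangentVectors hU hpU hf hfS (hB μ)
  have hx : ∀ x, fderiv ℝ f p x
      = inner ℝ (B (Fin.last n)) x * fderiv ℝ f p (B (Fin.last n)) := by
    intro x
    conv_lhs => rw [← B.sum_repr' x]
    rw [map_sum, Fin.sum_univ_castSucc]
    simp [hfB]
  have hc : fderiv ℝ f p (B (Fin.last n)) ≠ 0 := by
    intro h0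
    refine hd p ⟨hpU, hp⟩ (ContinuousLinearMap.ext fun x => ?_)
    simp [hx x, h0]
  have hsm : ∀ x ∈ U, fderiv ℝ (fun y => (fderiv ℝ f p (B (Fin.last n)))⁻¹ • f y) x
      = (fderiv ℝ f p (B (Fin.last n)))⁻¹ • fderiv ℝ f x := fun x hxU =>
    fderiv_fun_const_smul ((hf.contDiffAt (hU.mem_nhds hxU)).differentiableAt (by simp)) _
  refine ⟨U, hU, hpU, fun x => (fderiv ℝ f p (B (Fin.last n)))⁻¹ • f x, hf.const_smul _,
    fun x hxU => ?_, fun x hxU => ?_, fun x => ?_⟩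
  · simp [hfS x hxU, hc]
  · rw [hsm x hxU.1]
    exact smul_ne_zero (inv_ne_zero hc) (hd x hxU)
  · rw [hsm p hpU]
    simp only [smul_apply, smul_eq_mul, hx x]
    field_simp

/-- The principal directions for the value `k` span principal vectors for `k`. Closure of the tangent
space under sums comes from its description as the kernel of the differential. -/
theorem isPrincipalVector_sum (hS : IsSmoothHypersurface S) (hp : p ∈ S)
    (he : IsPrincipalFrame S N p κ e) (k : ℝ) (c : Fin n → ℝ) (hc : ∀ i, κ i ≠ k → c i = 0) :
    IsPrincipalVector S N p k (∑ i, c i • e i) := by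
  obtain ⟨U, hU, hpU, f, hf, hfS, hd⟩ := hS p hp
  constructor
  · refine mem_tangentVectors_of_fderiv_eq_zero hU hpU hp hf hfS (hd p ⟨hpU, hp⟩) ?_
    rw [map_sum]
    refine Finset.sum_eq_zero fun i _ => ?_
    rw [map_smul, fderiv_eq_zero_of_mem_tangentVectors hU hpU hf hfS (he.2.2 i).1, smul_zero]
  · rw [map_sum, ← Finset.sum_neg_distrib, Finset.smul_sum]
    refine Finset.sum_congr rfl fun i _ => ?_
    rw [map_smul, ← smul_neg, (he.2.2 i).2, smul_comm]
    by_cases h : κ i = k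
    · rw [h]
    · rw [hc i h]; simp

/-- The quadratic form `½ ∑ κ_i y_i²` whose graph osculates the hypersurface. -/
noncomputable def osculating (κ : Fin n → ℝ) (y : Fin n → ℝ) : ℝ :=
  1 / 2 * ∑ i, κ i * y i ^ 2

/-- `D` is the part of the unit ball above the paraboloid `ε q`, up to a layer of thickness `C ε²`,
where `q` is the osculating quadratic form. -/
structure IsParaboloidalCap (κ : Fin n → ℝ) (C ε : ℝ)
    (D : Set (EuclideanSpace ℝ (Fin (n + 1)))) : Prop where
  measurable : MeasurableSet D
  subset : D ⊆ Metric.closedBall 0 1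
  above : ∀ Y ∈ Metric.closedBall (0 : EuclideanSpace ℝ (Fin (n + 1))) 1,
    C * ε ^ 2 ≤ |Y (Fin.last n) - ε * osculating κ (fun i => Y i.castSucc)| →
      (Y ∈ D ↔ ε * osculating κ (fun i => Y i.castSucc) < Y (Fin.last n))

theorem abs_osculating_le (κ : Fin n → ℝ) {y : Fin n → ℝ} (hy : ∀ i, |y i| ≤ 1) :
    |osculating κ y| ≤ 1 / 2 * ∑ i, |κ i| := by
  rw [osculating, abs_mul, abs_of_pos (by norm_num : (0 : ℝ) < 1 / 2)]
  gcongr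
  refine (Finset.abs_sum_le_sum_abs _ _).trans (Finset.sum_le_sum fun i _ => ?_)
  rw [abs_mul, abs_pow]
  exact mul_le_of_le_one_right (abs_nonneg _) (pow_le_one₀ (abs_nonneg _) (hy i))

/-- If `F = ε h - ε² q` up to errors `O(ε² |h|) + O(ε³)`, then `F` has the sign of `h - ε q` as soon
as that difference is not `O(ε²)`. -/
theorem pos_iff_of_expansion {ε F h q a K Q M : ℝ} (hε : 0 < ε) (hK : 0 ≤ K) (hM : 0 ≤ M)
    (hεK : 3 * K * ε < 1) (hF : |F - ε * h - 1 / 2 * (ε * (ε * a))| ≤ M * ε ^ 3)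
    (ha : |a + 2 * q| ≤ 3 * K * |h|) (hq : |q| ≤ Q)
    (hC : (4 * (3 / 2 * K * Q + M) + 1) * ε ^ 2 ≤ |h - ε * q|) : 0 < F ↔ ε * q < h := by
  have hQ : 0 ≤ Q := (abs_nonneg q).trans hq
  have h6 : |h| ≤ |h - ε * q| + ε * Q := by
    calc |h| = |(h - ε * q) + ε * q| := by congr 1; ring
      _ ≤ |h - ε * q| + |ε * q| := abs_add_le _ _
      _ ≤ _ := by rw [abs_mul, abs_of_pos hε]; gcongr
  set δ := h - ε * q with hδ
  have h7 : |F - ε * δ| ≤ ε * (3 / 4 * |δ|) := by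
    have h8 : F - ε * δ = (F - ε * h - 1 / 2 * (ε * (ε * a)))
        + 1 / 2 * ε ^ 2 * (a + 2 * q) := by rw [hδ]; ring
    have h9 : |1 / 2 * ε ^ 2 * (a + 2 * q)| ≤ 1 / 2 * ε ^ 2 * (3 * K * (|δ| + ε * Q)) := by
      rw [abs_mul, abs_of_pos (by positivity)]
      gcongr
      exact ha.trans (by gcongr)
    have h10 : ε * (3 * K * ε) * |δ| ≤ ε * 1 * |δ| := by gcongr
    have h11 : ε * ((4 * (3 / 2 * K * Q + M) + 1) * ε ^ 2) ≤ ε * |δ| := by gcongr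
    have h12 : 0 < ε ^ 3 := by positivity
    rw [h8]
    refine (abs_add_le _ _).trans ((add_le_add hF h9).trans ?_)
    linarith
  have hδ0 : 0 < |δ| := lt_of_lt_of_le (by positivity) hC
  have h12 := abs_le.1 h7
  have hεδ : 0 < ε * |δ| := mul_pos hε hδ0
  rw [← sub_pos (a := h), ← hδ]
  rcases (abs_pos.1 hδ0).lt_or_gt with h13 | h13
  · rw [abs_of_neg h13] at h12 hεδ
    exact ⟨fun h14 => by linarith [h12.2], fun h14 => by linarith⟩
  · rw [abs_of_pos h13] at h12 hεδ
    exact ⟨fun _ => h13, fun _ => by linarith [h12.1]⟩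

/-- In the frame `B` of principal directions and normal, and at scale `ε`, the spherical component
agrees with the part of the unit ball above the osculating paraboloid, except in a layer of
thickness `O(ε²)` about it. -/
theorem exists_sphericalComponent_normal_form (hS : IsSmoothHypersurface S) (hp : p ∈ S)
    (hN : IsUnitNormalNear S N p) (he : IsPrincipalFrame S N p κ e)
    (B : OrthonormalBasis (Fin (n + 1)) ℝ (EuclideanSpace ℝ (Fin (n + 1))))
    (hBe : ∀ μ : Fin n, B μ.castSucc = e μ) (hBN : B (Fin.last n) = N p) :
    ∃ C ε₀ : ℝ, 0 < C ∧ 0 < ε₀ ∧ ∀ ε, 0 < ε → ε < ε₀ →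
      ∃ D : Set (EuclideanSpace ℝ (Fin (n + 1))), IsParaboloidalCap κ C ε D ∧
        ∀ Y, p + ε • B.repr.symm Y ∈ sphericalComponent S p (N p) ε ↔ Y ∈ D := by
  obtain ⟨U, hU, hpU, f, hf, hfS, hd, hfB⟩ := exists_defining_function hS hp B
    (fun μ => hBe μ ▸ (he.2.2 μ).1)
  have hfp : f p = 0 := (hfS p hpU).1 hp
  have hNN : ‖N p‖ = 1 := by rw [← hBN]; exact B.norm_eq_one _
  have hfN : fderiv ℝ f p (N p) = 1 := by
    rw [hfB, hBN, real_inner_self_eq_norm_sq, hNN]; norm_num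
  obtain ⟨ε₁, hε₁, h1⟩ := exists_sphericalComponent_eq hU hpU hf hfS hp hNN hfN
  obtain ⟨M, r, hM, hr, h2⟩ :=
    exists_abs_sub_taylor_two_le ((hf.contDiffAt (hU.mem_nhds hpU)).of_le (by norm_cast))
  set H := fderiv ℝ (fderiv ℝ f) p with hH
  -- The Hessian on tangent vectors.
  have hHe : ∀ (i : Fin n) (v : EuclideanSpace ℝ (Fin (n + 1))), inner ℝ (N p) v = 0 →
      H (e i) v = -(κ i * inner ℝ (e i) v) := by
    intro i v hv
    have hvt : v ∈ tangentVectors S p :=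
      mem_tangentVectors_of_fderiv_eq_zero hU hpU hp hf hfS (hd p ⟨hpU, hp⟩)
        (by rw [hfB, hBN, hv])
    rw [← inner_fderiv_normal_eq hU hpU hf hfS hd hp hN hfN (he.2.2 i).1 hvt,
      ← neg_neg (fderiv ℝ N p (e i)), (he.2.2 i).2, inner_neg_left, real_inner_smul_left]
  set K := ‖H‖ with hK
  have hK0 : 0 ≤ K := norm_nonneg H
  have hHle : ∀ x y, ‖x‖ ≤ 1 → ‖y‖ ≤ 1 → |H x y| ≤ K := fun x y hx hy =>
    calc |H x y| ≤ ‖H‖ * ‖x‖ * ‖y‖ := H.le_opNorm₂ x y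
      _ ≤ ‖H‖ * 1 * 1 := by gcongr
      _ = K := by ring
  -- Replacing `X` by its tangential part changes `H X X` by `O(|h|)`.
  have hquad : ∀ Y : EuclideanSpace ℝ (Fin (n + 1)), ‖Y‖ ≤ 1 →
      |H (B.repr.symm Y) (B.repr.symm Y) + 2 * osculating κ (fun i => Y i.castSucc)|
        ≤ 3 * K * |Y (Fin.last n)| := by
    intro Y hY
    set h := Y (Fin.last n) with hh
    set X := B.repr.symm Y with hX
    have hXs : X = ∑ i : Fin n, Y i.castSucc • e i + h • N p := by
      rw [hX, ← B.sum_repr_symm, Fin.sum_univ_castSucc]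
      simp [hBe, hBN, hh]
    have hXn : ‖X‖ ≤ 1 := by rw [hX, LinearIsometryEquiv.norm_map]; exact hY
    have hNX : inner ℝ (N p) X = h := by
      rw [← hBN, ← B.repr_apply_apply, hX]; simp [hh]
    have heX : ∀ i, inner ℝ (e i) X = Y i.castSucc := by
      intro i
      rw [← hBe, ← B.repr_apply_apply, hX]; simp
    have heN : ∀ i, inner ℝ (e i) (N p) = 0 := by
      intro i
      rw [← hBe, ← hBN]
      exact B.orthonormal.2 (Fin.castSucc_lt_last i).ne
    set x := X - h • N p with hx
    have hNx : inner ℝ (N p) x = 0 := by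
      rw [hx, inner_sub_right, real_inner_smul_right, hNX, real_inner_self_eq_norm_sq, hNN]
      ring
    have hxn : ‖x‖ ≤ 1 := by
      have h5 : ‖X‖ ^ 2 = ‖x‖ ^ 2 + ‖h • N p‖ ^ 2 := by
        have : X = x + h • N p := by rw [hx]; abel
        rw [this, norm_add_sq_real, real_inner_smul_right, real_inner_comm, hNx]
        ring
      nlinarith [norm_nonneg X, norm_nonneg x, sq_nonneg ‖h • N p‖]
    have hxx : H x x = -(2 * osculating κ (fun i => Y i.castSucc)) := by
      have h6 : x = ∑ i : Fin n, Y i.castSucc • e i := by rw [hx, hXs]; abel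
      conv_lhs => rw [show H x = ∑ i : Fin n, Y i.castSucc • H (e i) by rw [h6]; simp]
      simp only [sum_apply, smul_apply, osculating,
        hHe _ x hNx, smul_eq_mul]
      rw [← mul_assoc]
      norm_num
      refine Finset.sum_congr rfl fun i _ => ?_
      rw [hx, inner_sub_right, real_inner_smul_right, heX, heN]
      ring
    have h7 : H X X = H x x + h * (H (N p) X + H x (N p)) := by
      have : X = x + h • N p := by rw [hx]; abel
      conv_lhs => rw [this]
      conv_rhs => rw [show H (N p) X = H (N p) x + h * H (N p) (N p) by
        conv_lhs => rw [this]
        simp]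
      simp
      ring
    rw [h7, hxx, neg_add_eq_sub, sub_add_cancel, abs_mul]
    have h8 := hHle (N p) X hNN.le hXn
    have h9 := hHle x (N p) hxn hNN.le
    have h10 := abs_add_le (H (N p) X) (H x (N p))
    nlinarith [abs_nonneg h]
  set Q := 1 / 2 * ∑ i, |κ i| with hQ
  have hQ0 : 0 ≤ Q := by positivity
  refine ⟨4 * (3 / 2 * K * Q + M) + 1, min (min ε₁ r) (1 / (3 * K + 1)), by positivity,
    by positivity, fun ε hε hεlt => ?_⟩
  have hεε₁ : ε < ε₁ := hεlt.trans_le ((min_le_left _ _).trans (min_le_left _ _))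
  have hεr : ε < r := hεlt.trans_le ((min_le_left _ _).trans (min_le_right _ _))
  have hεK : 3 * K * ε < 1 := by
    have := hεlt.trans_le (min_le_right _ _)
    rw [lt_div_iff₀ (by positivity)] at this
    linarith
  obtain ⟨hBU, hcomp⟩ := h1 ε hε hεε₁
  have hmem : ∀ Y : EuclideanSpace ℝ (Fin (n + 1)),
      p + ε • B.repr.symm Y ∈ Metric.closedBall p ε ↔ Y ∈ Metric.closedBall 0 1 := by
    intro Y
    rw [mem_closedBall_iff_norm, mem_closedBall_zero_iff, add_sub_cancel_left, norm_smul,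
      LinearIsometryEquiv.norm_map, Real.norm_of_nonneg hε.le]
    constructor
    · intro h; exact le_of_mul_le_mul_left (by linarith) hε
    · intro h; nlinarith
  refine ⟨{Y | p + ε • B.repr.symm Y ∈ sphericalComponent S p (N p) ε}, ⟨?_, ?_, fun Y hY hYC => ?_⟩,
    fun Y => Iff.rfl⟩
  · have hop : IsOpen (U ∩ f ⁻¹' Set.Ioi 0) := hf.continuousOn.isOpen_inter_preimage hU isOpen_Ioi
    have : sphericalComponent S p (N p) ε = Metric.closedBall p ε ∩ (U ∩ f ⁻¹' Set.Ioi 0) := by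
      rw [hcomp]
      ext x
      exact ⟨fun hx => ⟨hx.1, hBU hx.1, hx.2⟩, fun hx => ⟨hx.1, hx.2.2⟩⟩
    have hcont : Continuous fun Y => p + ε • B.repr.symm Y := by fun_prop
    change MeasurableSet ((fun Y => p + ε • B.repr.symm Y) ⁻¹' _)
    rw [this]
    exact hcont.measurable (Metric.isClosed_closedBall.measurableSet.inter hop.measurableSet)
  · intro Y hY
    rw [Set.mem_ofPred_eq, hcomp] at hY
    exact (hmem Y).1 hY.1
  · rw [Set.mem_ofPred_eq, hcomp, Set.mem_ofPred_eq, hmem, and_iff_right hY]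
    have hY1 : ‖Y‖ ≤ 1 := mem_closedBall_zero_iff.1 hY
    set X := B.repr.symm Y with hX
    set h := Y (Fin.last n) with hh
    set q := osculating κ (fun i => Y i.castSucc) with hq
    have hXn : ‖X‖ ≤ 1 := by rw [hX, LinearIsometryEquiv.norm_map]; exact hY1
    have hqQ : |q| ≤ Q := abs_osculating_le κ fun i =>
      (PiLp.norm_apply_le Y i.castSucc).trans hY1
    have hεX : ‖ε • X‖ ≤ ε := by
      rw [norm_smul, Real.norm_of_nonneg hε.le]
      exact mul_le_of_le_one_right hε.le hXn
    have h3 := h2 (ε • X) (hεX.trans_lt hεr)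
    have h4 := hquad Y hY1
    have hNX : inner ℝ (B (Fin.last n)) X = h := by
      rw [← B.repr_apply_apply, hX]; simp [hh]
    rw [hfp, hfB, real_inner_smul_right, hNX] at h3
    simp only [map_smul, smul_apply, smul_eq_mul, sub_zero] at h3
    have h5 : M * ‖ε • X‖ ^ 3 ≤ M * ε ^ 3 := by gcongr
    exact pos_iff_of_expansion hε hK0 hM hεK (h3.trans h5) h4 hqQ hYC

end NormalForm

/-! ### Layers about graphs -/

section Layers

variable {n : ℕ}

/-- The horizontal part of a point of `ℝⁿ⁺¹`: its first `n` coordinates. -/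
noncomputable def horiz (Y : EuclideanSpace ℝ (Fin (n + 1))) : EuclideanSpace ℝ (Fin n) :=
  WithLp.toLp 2 fun i => Y i.castSucc

@[simp]
theorem horiz_apply (Y : EuclideanSpace ℝ (Fin (n + 1))) (i : Fin n) :
    horiz Y i = Y i.castSucc := rfl

theorem norm_sq_eq_horiz (Y : EuclideanSpace ℝ (Fin (n + 1))) :
    ‖Y‖ ^ 2 = ‖horiz Y‖ ^ 2 + Y (Fin.last n) ^ 2 := by
  rw [EuclideanSpace.real_norm_sq_eq, EuclideanSpace.real_norm_sq_eq, Fin.sum_univ_castSucc]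
  rfl

theorem continuous_horiz : Continuous (horiz (n := n)) := by
  unfold horiz
  fun_prop

theorem abs_coord_le_norm {m : ℕ} (Y : EuclideanSpace ℝ (Fin m)) (i : Fin m) : |Y i| ≤ ‖Y‖ :=
  PiLp.norm_apply_le Y i

theorem norm_horiz_le (Y : EuclideanSpace ℝ (Fin (n + 1))) : ‖horiz Y‖ ≤ ‖Y‖ := by
  have := norm_sq_eq_horiz Y
  nlinarith [norm_nonneg Y, norm_nonneg (horiz Y), sq_nonneg (Y (Fin.last n))]

theorem measurePreserving_horiz_last :
    MeasurePreserving (fun Y : EuclideanSpace ℝ (Fin (n + 1)) => (horiz Y, Y (Fin.last n)))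
      volume (volume.prod volume) := by
  have h1 := PiLp.volume_preserving_ofLp (Fin (n + 1))
  have h2 := volume_preserving_piFinSuccAbove (fun _ : Fin (n + 1) => ℝ) (Fin.last n)
  have h3 : MeasurePreserving (Prod.swap : ℝ × (Fin n → ℝ) → (Fin n → ℝ) × ℝ)
      (volume.prod volume) (volume.prod volume) := Measure.measurePreserving_swap
  have h4 := (PiLp.volume_preserving_toLp (Fin n)).prod (MeasurePreserving.id (volume : Measure ℝ))
  convert! h4.comp (h3.comp (h2.comp h1)) using 1
  ext Y
  · simp [horiz, MeasurableEquiv.piFinSuccAbove, Fin.init]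
  · simp [MeasurableEquiv.piFinSuccAbove]

/-- The points over `T` within vertical distance `w` of the graph of `a`. -/
def layer (T : Set (EuclideanSpace ℝ (Fin n))) (a : EuclideanSpace ℝ (Fin n) → ℝ) (w : ℝ) :
    Set (EuclideanSpace ℝ (Fin (n + 1))) :=
  {Y | horiz Y ∈ T ∧ |Y (Fin.last n) - a (horiz Y)| ≤ w}

theorem measurableSet_layer {T : Set (EuclideanSpace ℝ (Fin n))} (hT : MeasurableSet T)
    {a : EuclideanSpace ℝ (Fin n) → ℝ} (ha : Measurable a) (w : ℝ) :
    MeasurableSet (layer T a w) := by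
  have h := (continuous_horiz (n := n)).measurable
  have h2 : Measurable fun Y : EuclideanSpace ℝ (Fin (n + 1)) => Y (Fin.last n) := by fun_prop
  have h3 : Measurable fun Y => |Y (Fin.last n) - a (horiz Y)| := (h2.sub (ha.comp h)).abs
  exact (h hT).inter (measurableSet_le h3 measurable_const)

theorem volume_layer {T : Set (EuclideanSpace ℝ (Fin n))} (hT : MeasurableSet T)
    {a : EuclideanSpace ℝ (Fin n) → ℝ} (ha : Measurable a) (w : ℝ) :
    volume (layer T a w) = volume T * ENNReal.ofReal (2 * w) := by
  have hmeas : MeasurableSet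
      {z : EuclideanSpace ℝ (Fin n) × ℝ | z.1 ∈ T ∧ |z.2 - a z.1| ≤ w} :=
    (measurable_fst hT).inter
      (measurableSet_le (measurable_snd.sub (ha.comp measurable_fst)).abs measurable_const)
  have h1 := measurePreserving_horiz_last.measure_preimage hmeas.nullMeasurableSet
  have h2 : volume (layer T a w) = (volume.prod volume)
      {z : EuclideanSpace ℝ (Fin n) × ℝ | z.1 ∈ T ∧ |z.2 - a z.1| ≤ w} := h1
  rw [h2, Measure.prod_apply hmeas]
  have h3 : ∀ y, volume (Prod.mk y ⁻¹'
      {z : EuclideanSpace ℝ (Fin n) × ℝ | z.1 ∈ T ∧ |z.2 - a z.1| ≤ w})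
      = T.indicator (fun _ => ENNReal.ofReal (2 * w)) y := by
    intro y
    by_cases hy : y ∈ T
    · have : Prod.mk y ⁻¹' {z : EuclideanSpace ℝ (Fin n) × ℝ | z.1 ∈ T ∧ |z.2 - a z.1| ≤ w}
          = Metric.closedBall (a y) w := by
        ext h
        simp [hy, Real.dist_eq]
      rw [this, Real.volume_closedBall, Set.indicator_of_mem hy]
    · have : Prod.mk y ⁻¹' {z : EuclideanSpace ℝ (Fin n) × ℝ | z.1 ∈ T ∧ |z.2 - a z.1| ≤ w}
          = ∅ := by
        ext h
        simp [hy]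
      rw [this, Set.indicator_of_notMem hy, measure_empty]
  simp_rw [h3]
  rw [lintegral_indicator_const hT, mul_comm]

theorem integral_indicator_layer {T : Set (EuclideanSpace ℝ (Fin n))} (hT : MeasurableSet T)
    (hTf : volume T ≠ ⊤) {a : EuclideanSpace ℝ (Fin n) → ℝ} (ha : Measurable a) {w : ℝ}
    (hw : 0 ≤ w) :
    Integrable ((layer T a w).indicator fun _ => (1 : ℝ)) ∧
      ∫ Y, (layer T a w).indicator (fun _ => (1 : ℝ)) Y = volume.real T * (2 * w) := by
  have hm := measurableSet_layer hT ha w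
  have hv := volume_layer hT ha w
  have hfin : volume (layer T a w) ≠ ⊤ := by
    rw [hv]; exact ENNReal.mul_ne_top hTf ENNReal.ofReal_ne_top
  refine ⟨(integrable_indicator_iff hm).2 (integrableOn_const hfin), ?_⟩
  rw [integral_indicator_const _ hm, smul_eq_mul, mul_one, measureReal_def, hv,
    ENNReal.toReal_mul, ENNReal.toReal_ofReal (by positivity), measureReal_def]

/-- The signed indicator of the interval between `0` and `a`. -/
noncomputable def signedIndicator (a h : ℝ) : ℝ :=
  (Set.Ioc 0 a).indicator (fun _ => (1 : ℝ)) h - (Set.Ioc a 0).indicator (fun _ => (1 : ℝ)) h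

theorem signedIndicator_eq (a h : ℝ) :
    signedIndicator a h = (if 0 < h then 1 else 0) - (if a < h then 1 else 0) := by
  unfold signedIndicator
  simp only [Set.indicator_apply, Set.mem_Ioc]
  split_ifs <;> first | (exfalso; grind) | norm_num

theorem abs_signedIndicator_le (a h : ℝ) : |signedIndicator a h| ≤ if |h| ≤ |a| then 1 else 0 := by
  rw [signedIndicator_eq]
  split_ifs <;> first
    | (exfalso; rcases abs_cases h with h' | h' <;> rcases abs_cases a with h'' | h'' <;> linarith)
    | norm_num

theorem integral_signedIndicator (a : ℝ) : ∫ h, signedIndicator a h = a := by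
  have h1 : ∀ x y : ℝ, Integrable ((Set.Ioc x y).indicator fun _ => (1 : ℝ)) := fun x y =>
    (integrable_indicator_iff measurableSet_Ioc).2 (integrableOn_const (by simp))
  unfold signedIndicator
  rw [integral_sub (h1 _ _) (h1 _ _), integral_indicator_const _ measurableSet_Ioc,
    integral_indicator_const _ measurableSet_Ioc]
  rcases le_total 0 a with h | h <;> simp [Measure.real, h]

theorem measurable_signedIndicator {α : Type*} [MeasurableSpace α] {a h : α → ℝ}
    (ha : Measurable a) (hh : Measurable h) : Measurable fun x => signedIndicator (a x) (h x) := by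
  simp_rw [signedIndicator_eq]
  exact (Measurable.ite (measurableSet_lt measurable_const hh) measurable_const
    measurable_const).sub (Measurable.ite (measurableSet_lt ha hh) measurable_const
    measurable_const)

/-- Fubini over the region between the disk and the graph of `a`, counted with sign. -/
theorem integral_mul_signedIndicator {T : Set (EuclideanSpace ℝ (Fin n))} (hT : MeasurableSet T)
    (hTf : volume T ≠ ⊤) {a ψ : EuclideanSpace ℝ (Fin n) → ℝ} (ha : Measurable a)
    (hψ : Measurable ψ) {c : ℝ} (hac : ∀ y ∈ T, |a y| ≤ c) (hc : 0 ≤ c)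
    (hψ1 : ∀ y ∈ T, |ψ y| ≤ 1) :
    Integrable (fun Y : EuclideanSpace ℝ (Fin (n + 1)) =>
        T.indicator ψ (horiz Y) * signedIndicator (a (horiz Y)) (Y (Fin.last n))) ∧
      ∫ Y : EuclideanSpace ℝ (Fin (n + 1)),
        T.indicator ψ (horiz Y) * signedIndicator (a (horiz Y)) (Y (Fin.last n))
          = ∫ y in T, a y * ψ y := by
  have hh := (continuous_horiz (n := n)).measurable
  have hl : Measurable fun Y : EuclideanSpace ℝ (Fin (n + 1)) => Y (Fin.last n) := by fun_prop
  have hint : Integrable (fun Y : EuclideanSpace ℝ (Fin (n + 1)) =>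
        T.indicator ψ (horiz Y) * signedIndicator (a (horiz Y)) (Y (Fin.last n))) := by
    refine (integral_indicator_layer hT hTf (measurable_const (a := (0 : ℝ))) hc).1.mono'
      (((hψ.indicator hT).comp hh).mul
        (measurable_signedIndicator (ha.comp hh) hl)).aestronglyMeasurable
      (Eventually.of_forall fun Y => ?_)
    by_cases hY : horiz Y ∈ T
    · rw [Set.indicator_of_mem hY, norm_mul, Real.norm_eq_abs, Real.norm_eq_abs]
      have h1 := abs_signedIndicator_le (a (horiz Y)) (Y (Fin.last n))
      have h2 : (if |Y (Fin.last n)| ≤ |a (horiz Y)| then (1 : ℝ) else 0)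
          ≤ (layer T (fun _ => 0) c).indicator (fun _ => (1 : ℝ)) Y := by
        split_ifs with h3
        · rw [Set.indicator_of_mem]
          exact ⟨hY, by rw [sub_zero]; exact h3.trans (hac _ hY)⟩
        · exact Set.indicator_nonneg (fun _ _ => zero_le_one) _
      calc _ ≤ 1 * |signedIndicator (a (horiz Y)) (Y (Fin.last n))| := by
            gcongr; exact hψ1 _ hY
        _ ≤ _ := by rw [one_mul]; exact h1.trans h2
    · rw [Set.indicator_of_notMem hY]
      simp only [zero_mul, norm_zero]
      exact Set.indicator_nonneg (fun _ _ => zero_le_one) _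
  refine ⟨hint, ?_⟩
  let G : EuclideanSpace ℝ (Fin n) × ℝ → ℝ := fun z =>
    T.indicator ψ z.1 * signedIndicator (a z.1) z.2
  have hGm : Measurable G := ((hψ.indicator hT).comp measurable_fst).mul
    (measurable_signedIndicator (ha.comp measurable_fst) measurable_snd)
  have hmp := measurePreserving_horiz_last (n := n)
  have h1 : ∫ Y : EuclideanSpace ℝ (Fin (n + 1)), G (horiz Y, Y (Fin.last n))
      = ∫ z, G z ∂(volume.prod volume) := by
    rw [← hmp.map_eq, integral_map hmp.measurable.aemeasurable hGm.aestronglyMeasurable]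
  have hGi : Integrable G (volume.prod volume) := by
    rw [← hmp.map_eq, integrable_map_measure hGm.aestronglyMeasurable hmp.measurable.aemeasurable]
    exact hint
  change ∫ Y : EuclideanSpace ℝ (Fin (n + 1)), G (horiz Y, Y (Fin.last n)) = _
  rw [h1, integral_prod _ hGi, ← integral_indicator hT]
  refine integral_congr_ae (Eventually.of_forall fun y => ?_)
  simp only [G, integral_const_mul, integral_signedIndicator]
  by_cases hy : y ∈ T
  · simp [hy, mul_comm]
  · simp [hy]

end Layers

/-! ### Comparison with the upper half ball -/

section Comparison

variable {n : ℕ}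

/-- The closed unit ball intersected with the open upper half-space. -/
def upperHalfBall (n : ℕ) : Set (EuclideanSpace ℝ (Fin (n + 1))) :=
  {Y ∈ Metric.closedBall 0 1 | 0 < Y (Fin.last n)}

theorem measurableSet_upperHalfBall : MeasurableSet (upperHalfBall n) := by
  have h2 : Measurable fun Y : EuclideanSpace ℝ (Fin (n + 1)) => Y (Fin.last n) := by fun_prop
  exact Metric.isClosed_closedBall.measurableSet.inter (measurableSet_lt measurable_const h2)

theorem integrableOn_of_abs_le_one {m : ℕ} {D : Set (EuclideanSpace ℝ (Fin m))}
    (hD : D ⊆ Metric.closedBall 0 1) {ψ : EuclideanSpace ℝ (Fin m) → ℝ} (hψ : Measurable ψ)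
    (hψ1 : ∀ Y ∈ Metric.closedBall (0 : EuclideanSpace ℝ (Fin m)) 1, |ψ Y| ≤ 1) :
    IntegrableOn ψ D := by
  refine IntegrableOn.mono_set ?_ hD
  exact Measure.integrableOn_of_bounded (M := 1) measure_closedBall_lt_top.ne
    hψ.aestronglyMeasurable
    ((ae_restrict_iff' Metric.isClosed_closedBall.measurableSet).2 (Eventually.of_forall hψ1))

/-- The part of the unit disk at distance at most `c` from its boundary has volume `O(c)`. -/
theorem volume_shell_le {c : ℝ} (hc : 0 ≤ c) (hc1 : c ≤ 1) :
    volume.real (Metric.closedBall (0 : EuclideanSpace ℝ (Fin n)) 1 \ Metric.closedBall 0 (1 - c))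
      ≤ volume.real (Metric.closedBall (0 : EuclideanSpace ℝ (Fin n)) 1) * (n * c) := by
  rw [measureReal_sdiff (Metric.closedBall_subset_closedBall (by linarith))
    Metric.isClosed_closedBall.measurableSet measure_closedBall_lt_top.ne,
    Measure.addHaar_real_closedBall' volume _ (sub_nonneg.2 hc1), finrank_euclideanSpace,
    Fintype.card_fin]
  have h1 := one_add_mul_le_pow (a := -c) (by linarith) n
  have h2 : (1 - c) ^ n = (1 + -c) ^ n := by ring_nf
  have h3 : 0 ≤ volume.real (Metric.closedBall (0 : EuclideanSpace ℝ (Fin n)) 1) :=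
    measureReal_nonneg
  rw [h2]
  nlinarith

/-- Replacing the upper half ball by the part of the ball above the graph of a small function `a`
changes an integral by the integral of `a` times the restriction of the integrand to the disk, up
to quadratic errors: from the layer about the graph where `D` is not controlled, from the variation
of `ψ` between the disk and the graph, and from the part of the graph outside the ball. -/
theorem abs_integral_sub_add_le {a : EuclideanSpace ℝ (Fin n) → ℝ} (ha : Measurable a) {c w : ℝ}
    (hc : 0 ≤ c) (hc1 : c ≤ 1) (hw : 0 ≤ w)
    (hac : ∀ y ∈ Metric.closedBall (0 : EuclideanSpace ℝ (Fin n)) 1, |a y| ≤ c)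
    {D : Set (EuclideanSpace ℝ (Fin (n + 1)))} (hD : MeasurableSet D)
    (hDball : D ⊆ Metric.closedBall 0 1)
    (hDa : ∀ Y ∈ Metric.closedBall (0 : EuclideanSpace ℝ (Fin (n + 1))) 1,
      w ≤ |Y (Fin.last n) - a (horiz Y)| → (Y ∈ D ↔ a (horiz Y) < Y (Fin.last n)))
    {ψ : EuclideanSpace ℝ (Fin (n + 1)) → ℝ} (hψ : Measurable ψ)
    (hψ1 : ∀ Y ∈ Metric.closedBall (0 : EuclideanSpace ℝ (Fin (n + 1))) 1, |ψ Y| ≤ 1)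
    {ψ₀ : EuclideanSpace ℝ (Fin n) → ℝ} (hψ₀ : Measurable ψ₀)
    (hψ₀1 : ∀ y ∈ Metric.closedBall (0 : EuclideanSpace ℝ (Fin n)) 1, |ψ₀ y| ≤ 1)
    (hψψ₀ : ∀ Y ∈ Metric.closedBall (0 : EuclideanSpace ℝ (Fin (n + 1))) 1,
      |ψ Y - ψ₀ (horiz Y)| ≤ |Y (Fin.last n)|) :
    |(∫ Y in D, ψ Y) - (∫ Y in upperHalfBall n, ψ Y)
        + ∫ y in Metric.closedBall (0 : EuclideanSpace ℝ (Fin n)) 1, a y * ψ₀ y|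
      ≤ volume.real (Metric.closedBall (0 : EuclideanSpace ℝ (Fin n)) 1)
        * (2 * w + (2 + 2 * n) * c ^ 2) := by
  set T : Set (EuclideanSpace ℝ (Fin n)) := Metric.closedBall 0 1 with hT
  have hTm : MeasurableSet T := Metric.isClosed_closedBall.measurableSet
  have hTf : volume T ≠ ⊤ := measure_closedBall_lt_top.ne
  set T' : Set (EuclideanSpace ℝ (Fin n)) := T \ Metric.closedBall 0 (1 - c) with hT'
  have hT'm : MeasurableSet T' := hTm.diff Metric.isClosed_closedBall.measurableSet
  have hT'f : volume T' ≠ ⊤ := ne_top_of_le_ne_top hTf (measure_mono Set.sdiff_subset)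
  obtain ⟨i1, e1⟩ := integral_indicator_layer hTm hTf ha hw
  obtain ⟨i2, e2⟩ := integral_indicator_layer hTm hTf (measurable_const (a := (0 : ℝ))) hc
  obtain ⟨i3, e3⟩ := integral_indicator_layer hT'm hT'f (measurable_const (a := (0 : ℝ))) hc
  obtain ⟨i4, e4⟩ := integral_mul_signedIndicator hTm hTf ha hψ₀ hac hc hψ₀1
  have hHball : upperHalfBall n ⊆ Metric.closedBall 0 1 := fun Y hY => hY.1
  have i5 := (integrable_indicator_iff hD).2 (integrableOn_of_abs_le_one hDball hψ hψ1)
  have i6 := (integrable_indicator_iff measurableSet_upperHalfBall).2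
    (integrableOn_of_abs_le_one hHball hψ hψ1)
  rw [← integral_indicator hD, ← integral_indicator measurableSet_upperHalfBall, ← e4,
    ← integral_sub i5 i6, ← integral_add (f := fun Y => D.indicator ψ Y
      - (upperHalfBall n).indicator ψ Y) (i5.sub i6) i4, ← Real.norm_eq_abs]
  have hbound : volume.real T * (2 * w) + c * (volume.real T * (2 * c))
      + volume.real T' * (2 * c) ≤ volume.real T * (2 * w + (2 + 2 * n) * c ^ 2) := by
    have := mul_le_mul_of_nonneg_right (volume_shell_le (n := n) hc hc1)
      (by positivity : 0 ≤ 2 * c)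
    calc _ ≤ volume.real T * (2 * w) + c * (volume.real T * (2 * c))
          + volume.real T * (n * c) * (2 * c) := by gcongr
      _ = _ := by ring
  refine le_trans ?_ hbound
  rw [← e1, ← e2, ← e3, ← integral_const_mul, ← integral_add i1 (i2.const_mul c),
    ← integral_add (f := fun Y => (layer T a w).indicator (fun _ => (1 : ℝ)) Y
      + c * (layer T (fun _ => 0) c).indicator (fun _ => (1 : ℝ)) Y)
      (i1.add (i2.const_mul c)) i3]
  refine norm_integral_le_of_norm_le ((i1.add (i2.const_mul c)).add i3)
    (Eventually.of_forall fun Y => ?_)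
  have n1 : 0 ≤ (layer T a w).indicator (fun _ => (1 : ℝ)) Y :=
    Set.indicator_nonneg (fun _ _ => zero_le_one) _
  have n2 : 0 ≤ (layer T (fun _ => 0) c).indicator (fun _ => (1 : ℝ)) Y :=
    Set.indicator_nonneg (fun _ _ => zero_le_one) _
  have n3 : 0 ≤ (layer T' (fun _ => 0) c).indicator (fun _ => (1 : ℝ)) Y :=
    Set.indicator_nonneg (fun _ _ => zero_le_one) _
  by_cases hYT : horiz Y ∈ T
  swap
  · have hYb : Y ∉ Metric.closedBall (0 : EuclideanSpace ℝ (Fin (n + 1))) 1 := fun h =>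
      hYT (mem_closedBall_zero_iff.2 ((norm_horiz_le Y).trans (mem_closedBall_zero_iff.1 h)))
    rw [Set.indicator_of_notMem (fun h => hYb (hDball h)),
      Set.indicator_of_notMem (fun h => hYb (hHball h)), Set.indicator_of_notMem hYT]
    simp only [zero_mul, sub_zero, add_zero, norm_zero]
    positivity
  rw [Set.indicator_of_mem hYT ψ₀]
  have hs := abs_signedIndicator_le (a (horiz Y)) (Y (Fin.last n))
  by_cases hYb : Y ∈ Metric.closedBall (0 : EuclideanSpace ℝ (Fin (n + 1))) 1
  · have hH : (upperHalfBall n).indicator ψ Y = ψ Y * if 0 < Y (Fin.last n) then 1 else 0 := by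
      by_cases h : 0 < Y (Fin.last n)
      · rw [Set.indicator_of_mem (show Y ∈ upperHalfBall n from ⟨hYb, h⟩), if_pos h, mul_one]
      · rw [Set.indicator_of_notMem (fun h' => h h'.2), if_neg h, mul_zero]
    have h1 : |D.indicator ψ Y - ψ Y * if a (horiz Y) < Y (Fin.last n) then 1 else 0|
        ≤ (layer T a w).indicator (fun _ => (1 : ℝ)) Y := by
      by_cases hl : Y ∈ layer T a w
      · rw [Set.indicator_of_mem hl]
        by_cases hYD : Y ∈ D
        · rw [Set.indicator_of_mem hYD]
          split_ifs
          · simp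
          · simpa using hψ1 Y hYb
        · rw [Set.indicator_of_notMem hYD]
          split_ifs
          · simpa using hψ1 Y hYb
          · simp
      · have h2 : w ≤ |Y (Fin.last n) - a (horiz Y)| := by
          by_contra! h3
          exact hl ⟨hYT, h3.le⟩
        have h3 := hDa Y hYb h2
        refine le_trans (le_of_eq ?_) n1
        by_cases hYD : Y ∈ D
        · rw [Set.indicator_of_mem hYD, if_pos (h3.1 hYD)]; simp
        · rw [Set.indicator_of_notMem hYD, if_neg (fun h => hYD (h3.2 h))]; simp
    have h4 : |(ψ₀ (horiz Y) - ψ Y) * signedIndicator (a (horiz Y)) (Y (Fin.last n))|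
        ≤ c * (layer T (fun _ => 0) c).indicator (fun _ => (1 : ℝ)) Y := by
      rw [abs_mul, abs_sub_comm]
      by_cases h5 : |Y (Fin.last n)| ≤ |a (horiz Y)|
      · rw [if_pos h5] at hs
        have h6 : |Y (Fin.last n)| ≤ c := h5.trans (hac _ hYT)
        rw [Set.indicator_of_mem (show Y ∈ layer T (fun _ => 0) c from
          ⟨hYT, by rw [sub_zero]; exact h6⟩)]
        exact mul_le_mul ((hψψ₀ Y hYb).trans h6) hs (abs_nonneg _) hc
      · rw [if_neg h5] at hs
        rw [le_antisymm hs (abs_nonneg _), mul_zero]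
        positivity
    -- Inside the ball, split off the error of `D` against the graph; the rest is `(ψ₀ - ψ)` on the
    -- region between the disk and the graph.
    have h7 : D.indicator ψ Y - (upperHalfBall n).indicator ψ Y
          + ψ₀ (horiz Y) * signedIndicator (a (horiz Y)) (Y (Fin.last n))
        = (D.indicator ψ Y - ψ Y * if a (horiz Y) < Y (Fin.last n) then 1 else 0)
          + (ψ₀ (horiz Y) - ψ Y) * signedIndicator (a (horiz Y)) (Y (Fin.last n)) := by
      rw [hH, signedIndicator_eq]
      ring
    rw [h7, Real.norm_eq_abs]
    linarith [abs_add_le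
      (D.indicator ψ Y - ψ Y * if a (horiz Y) < Y (Fin.last n) then 1 else 0)
      ((ψ₀ (horiz Y) - ψ Y) * signedIndicator (a (horiz Y)) (Y (Fin.last n)))]
  · -- Outside the ball but over the disk, only points near the equator contribute.
    rw [Set.indicator_of_notMem (fun h => hYb (hDball h)),
      Set.indicator_of_notMem (fun h => hYb (hHball h)), sub_zero, zero_add, norm_mul,
      Real.norm_eq_abs, Real.norm_eq_abs]
    have h8 : |ψ₀ (horiz Y)| * |signedIndicator (a (horiz Y)) (Y (Fin.last n))|
        ≤ 1 * |signedIndicator (a (horiz Y)) (Y (Fin.last n))| := by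
      gcongr
      exact hψ₀1 _ hYT
    by_cases h5 : |Y (Fin.last n)| ≤ |a (horiz Y)|
    · rw [if_pos h5] at hs
      have h6 : |Y (Fin.last n)| ≤ c := h5.trans (hac _ hYT)
      have h9 : Y ∈ layer T' (fun _ => 0) c := by
        refine ⟨⟨hYT, fun h => hYb ?_⟩, by rw [sub_zero]; exact h6⟩
        -- `(1 - c)² + c² ≤ 1` since `0 ≤ c ≤ 1`
        rw [mem_closedBall_zero_iff] at h ⊢
        have h10 := norm_sq_eq_horiz Y
        have h11 : ‖horiz Y‖ ^ 2 ≤ (1 - c) ^ 2 := by gcongr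
        have h12 : Y (Fin.last n) ^ 2 ≤ c ^ 2 := sq_le_sq' (abs_le.1 h6).1 (abs_le.1 h6).2
        have h13 : c * c ≤ c * 1 := by gcongr
        exact (sq_le_one_iff₀ (norm_nonneg _)).1 (by nlinarith)
      rw [Set.indicator_of_mem h9]
      have : 0 ≤ c * (layer T (fun _ => 0) c).indicator (fun _ => (1 : ℝ)) Y := by positivity
      linarith
    · rw [if_neg h5] at hs
      have : 0 ≤ c * (layer T (fun _ => 0) c).indicator (fun _ => (1 : ℝ)) Y := by positivity
      linarith

end Comparison

/-! ### Moments of the ball -/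

section Moments

variable {m n : ℕ}

theorem setIntegral_linearIsometryEquiv
    (L : EuclideanSpace ℝ (Fin m) ≃ₗᵢ[ℝ] EuclideanSpace ℝ (Fin m))
    {D : Set (EuclideanSpace ℝ (Fin m))} (hD : L ⁻¹' D = D) (g : EuclideanSpace ℝ (Fin m) → ℝ) :
    ∫ Y in D, g (L Y) = ∫ Y in D, g Y := by
  have := L.measurePreserving.setIntegral_preimage_emb
    L.toHomeomorph.measurableEmbedding g D
  rwa [hD] at this

theorem preimage_closedBall_zero (L : EuclideanSpace ℝ (Fin m) ≃ₗᵢ[ℝ] EuclideanSpace ℝ (Fin m)) :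
    L ⁻¹' Metric.closedBall 0 1 = Metric.closedBall 0 1 := by
  ext Y
  simp

/-- The reflection `Y_i ↦ -Y_i`. -/
noncomputable def coordReflection (i : Fin m) :
    EuclideanSpace ℝ (Fin m) ≃ₗᵢ[ℝ] EuclideanSpace ℝ (Fin m) :=
  LinearIsometryEquiv.piLpCongrRight 2 fun j =>
    if j = i then LinearIsometryEquiv.neg ℝ else LinearIsometryEquiv.refl ℝ ℝ

theorem coordReflection_self (i : Fin m) (Y : EuclideanSpace ℝ (Fin m)) :
    coordReflection i Y i = -Y i := by
  simp [coordReflection, LinearIsometryEquiv.piLpCongrRight_apply]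

theorem coordReflection_of_ne {i j : Fin m} (h : j ≠ i) (Y : EuclideanSpace ℝ (Fin m)) :
    coordReflection i Y j = Y j := by
  simp [coordReflection, LinearIsometryEquiv.piLpCongrRight_apply, h]

theorem setIntegral_eq_zero_of_odd (i : Fin m) {D : Set (EuclideanSpace ℝ (Fin m))}
    (hD : coordReflection i ⁻¹' D = D) {g : EuclideanSpace ℝ (Fin m) → ℝ}
    (hg : ∀ Y, g (coordReflection i Y) = -g Y) : ∫ Y in D, g Y = 0 := by
  have := setIntegral_linearIsometryEquiv (coordReflection i) hD g
  simp only [hg, integral_neg] at this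
  linarith

/-- A moment in the direction `u` over the ball depends on the length of `u` alone. -/
theorem integral_inner_pow_eq {u v : EuclideanSpace ℝ (Fin m)} (h : ‖u‖ = ‖v‖) (k : ℕ) :
    ∫ Y in Metric.closedBall (0 : EuclideanSpace ℝ (Fin m)) 1, inner ℝ u Y ^ k
      = ∫ Y in Metric.closedBall (0 : EuclideanSpace ℝ (Fin m)) 1, inner ℝ v Y ^ k := by
  have hR := Submodule.reflection_sub h
  rw [← setIntegral_linearIsometryEquiv (Submodule.reflection (ℝ ∙ (u - v))ᗮ)
    (preimage_closedBall_zero _) fun Y => inner ℝ v Y ^ k]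
  refine integral_congr_ae (Eventually.of_forall fun Y => ?_)
  have h2 : ∀ L : EuclideanSpace ℝ (Fin m) ≃ₗᵢ[ℝ] EuclideanSpace ℝ (Fin m), L u = v →
      inner ℝ u Y ^ k = inner ℝ v (L Y) ^ k := fun L hL => by rw [← hL, L.inner_map_map]
  exact h2 _ hR

theorem integrableOn_closedBall {g : EuclideanSpace ℝ (Fin m) → ℝ} (hg : Continuous g) :
    IntegrableOn g (Metric.closedBall 0 1) :=
  hg.continuousOn.integrableOn_compact (isCompact_closedBall 0 1)

theorem integral_norm_pow (hm : 1 ≤ m) (k : ℕ) :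
    ∫ Y in Metric.closedBall (0 : EuclideanSpace ℝ (Fin m)) 1, ‖Y‖ ^ k
      = volume.real (Metric.closedBall (0 : EuclideanSpace ℝ (Fin m)) 1) * m / (m + k) := by
  have : Nonempty (Fin m) := ⟨⟨0, hm⟩⟩
  have h1 := integral_fun_norm_addHaar (volume : Measure (EuclideanSpace ℝ (Fin m)))
    ((Set.Iic (1 : ℝ)).indicator fun r => r ^ k)
  have h2 : (fun Y : EuclideanSpace ℝ (Fin m) => (Set.Iic (1 : ℝ)).indicator (fun r => r ^ k) ‖Y‖)
      = (Metric.closedBall 0 1).indicator fun Y => ‖Y‖ ^ k := by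
    ext Y
    by_cases hY : ‖Y‖ ≤ 1
    · rw [Set.indicator_of_mem (Set.mem_Iic.2 hY),
        Set.indicator_of_mem (mem_closedBall_zero_iff.2 hY)]
    · rw [Set.indicator_of_notMem (fun h => hY (Set.mem_Iic.1 h)),
        Set.indicator_of_notMem (fun h => hY (mem_closedBall_zero_iff.1 h))]
  have h3 : ∫ r in Set.Ioi (0 : ℝ), r ^ (Module.finrank ℝ (EuclideanSpace ℝ (Fin m)) - 1) •
      (Set.Iic (1 : ℝ)).indicator (fun r => r ^ k) r = 1 / (m + k) := by
    have h4 : ∀ r : ℝ, r ^ (Module.finrank ℝ (EuclideanSpace ℝ (Fin m)) - 1) •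
        (Set.Iic (1 : ℝ)).indicator (fun r => r ^ k) r
        = (Set.Iic (1 : ℝ)).indicator (fun r => r ^ (m - 1 + k)) r := by
      intro r
      by_cases hr : r ≤ 1 <;> simp [hr, pow_add]
    simp_rw [h4]
    rw [setIntegral_indicator measurableSet_Iic, Set.Ioi_inter_Iic,
      ← intervalIntegral.integral_of_le zero_le_one, integral_pow]
    have h5 : ((m - 1 + k : ℕ) : ℝ) + 1 = m + k := by
      have : m - 1 + k + 1 = m + k := by omega
      exact_mod_cast this
    rw [h5]
    simp
  rw [h2, integral_indicator Metric.isClosed_closedBall.measurableSet, h3,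
    finrank_euclideanSpace, Fintype.card_fin] at h1
  rw [h1, ← Measure.addHaar_real_closedBall_eq_addHaar_real_ball]
  simp
  ring

theorem integral_sq (hm : 1 ≤ m) (i : Fin m) :
    ∫ Y in Metric.closedBall (0 : EuclideanSpace ℝ (Fin m)) 1, Y i ^ 2
      = volume.real (Metric.closedBall (0 : EuclideanSpace ℝ (Fin m)) 1) / (m + 2) := by
  have h1 := integral_norm_pow hm 2
  simp_rw [EuclideanSpace.real_norm_sq_eq] at h1
  rw [integral_finsetSum _ fun j _ => integrableOn_closedBall (by fun_prop)] at h1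
  have h2 : ∀ j : Fin m, ∫ Y in Metric.closedBall (0 : EuclideanSpace ℝ (Fin m)) 1, Y j ^ 2
      = ∫ Y in Metric.closedBall (0 : EuclideanSpace ℝ (Fin m)) 1, Y i ^ 2 := by
    intro j
    have := integral_inner_pow_eq (u := EuclideanSpace.single j (1 : ℝ))
      (v := EuclideanSpace.single i (1 : ℝ)) (by simp) 2
    simpa [EuclideanSpace.inner_single_left] using this
  simp_rw [h2] at h1
  have hm0 : (m : ℝ) ≠ 0 := by positivity
  simp only [Finset.sum_const, Finset.card_univ, Fintype.card_fin, nsmul_eq_mul] at h1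
  field_simp at h1 ⊢
  push_cast at h1
  exact h1

/-- The fourth moments of the ball: polarizing `∫ ⟨u, Y⟩⁴` gives `∫ Y_i⁴ = 3 ∫ Y_i² Y_j²`, and
`∫ ‖Y‖⁴` fixes the constant. -/
theorem integral_sq_mul_sq (hm : 1 ≤ m) (i j : Fin m) :
    ∫ Y in Metric.closedBall (0 : EuclideanSpace ℝ (Fin m)) 1, Y i ^ 2 * Y j ^ 2
      = (if i = j then 3 else 1) *
        (volume.real (Metric.closedBall (0 : EuclideanSpace ℝ (Fin m)) 1) / ((m + 2) * (m + 4))) := by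
  set a := ∫ Y in Metric.closedBall (0 : EuclideanSpace ℝ (Fin m)) 1, Y i ^ 4 with ha
  have h4 : ∀ k : Fin m, ∫ Y in Metric.closedBall (0 : EuclideanSpace ℝ (Fin m)) 1, Y k ^ 4
      = a := by
    intro k
    have := integral_inner_pow_eq (u := EuclideanSpace.single k (1 : ℝ))
      (v := EuclideanSpace.single i (1 : ℝ)) (by simp) 4
    simpa [EuclideanSpace.inner_single_left] using this
  have h22 : ∀ k l : Fin m, k ≠ l →
      ∫ Y in Metric.closedBall (0 : EuclideanSpace ℝ (Fin m)) 1, Y k ^ 2 * Y l ^ 2 = a / 3 := by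
    intro k l hkl
    have hn : ∀ s : ℝ, s ^ 2 = 1 →
        ‖EuclideanSpace.single k (1 : ℝ) + EuclideanSpace.single l s‖ ^ 2 = 2 := by
      intro s hs
      rw [norm_add_sq_real]
      simp [EuclideanSpace.inner_single_left, hkl, hs]
      norm_num
    have hns : ∀ s : ℝ, s ^ 2 = 1 →
        ‖EuclideanSpace.single k (1 : ℝ) + EuclideanSpace.single l s‖
          = ‖EuclideanSpace.single k (√2)‖ := by
      intro s hs
      rw [← Real.sqrt_sq (norm_nonneg _), hn s hs]
      simp [abs_of_nonneg]
    have e1 := integral_inner_pow_eq (hns 1 (by norm_num)) 4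
    have e2 := integral_inner_pow_eq (hns (-1) (by norm_num)) 4
    simp only [inner_add_left, EuclideanSpace.inner_single_left, conj_trivial] at e1 e2
    have hs4 : √2 ^ 4 = 4 := by
      rw [show (4 : ℕ) = 2 * 2 by rfl, pow_mul, Real.sq_sqrt (by norm_num)]; norm_num
    simp only [mul_pow, hs4, integral_const_mul, h4] at e1 e2
    have e3 := congrArg₂ (· + ·) e1 e2
    rw [← integral_add (integrableOn_closedBall (by fun_prop))
      (integrableOn_closedBall (by fun_prop))] at e3
    have e4 : ∀ Y : EuclideanSpace ℝ (Fin m), (1 * Y k + 1 * Y l) ^ 4 + (1 * Y k + -1 * Y l) ^ 4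
        = 2 * Y k ^ 4 + 2 * Y l ^ 4 + 12 * (Y k ^ 2 * Y l ^ 2) := fun Y => by ring
    simp_rw [e4] at e3
    rw [integral_add (integrableOn_closedBall (by fun_prop))
      (integrableOn_closedBall (by fun_prop)), integral_add (integrableOn_closedBall (by fun_prop))
      (integrableOn_closedBall (by fun_prop)), integral_const_mul, integral_const_mul,
      integral_const_mul, h4, h4] at e3
    linarith
  have hkl : ∀ k l : Fin m,
      ∫ Y in Metric.closedBall (0 : EuclideanSpace ℝ (Fin m)) 1, Y k ^ 2 * Y l ^ 2
        = a / 3 + if k = l then 2 * a / 3 else 0 := by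
    intro k l
    split_ifs with h
    · subst h
      have : ∀ Y : EuclideanSpace ℝ (Fin m), Y k ^ 2 * Y k ^ 2 = Y k ^ 4 := fun Y => by ring
      simp_rw [this, h4]
      ring
    · rw [h22 k l h, add_zero]
  have h1 := integral_norm_pow hm 4
  have h5 : ∀ Y : EuclideanSpace ℝ (Fin m), ‖Y‖ ^ 4 = ∑ k, ∑ l, Y k ^ 2 * Y l ^ 2 := by
    intro Y
    rw [show (4 : ℕ) = 2 * 2 by rfl, pow_mul, EuclideanSpace.real_norm_sq_eq, sq,
      Finset.sum_mul_sum]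
  simp_rw [h5] at h1
  rw [integral_finsetSum _ fun j _ => integrableOn_closedBall (by fun_prop)] at h1
  have h6 : ∀ k : Fin m,
      ∫ Y in Metric.closedBall (0 : EuclideanSpace ℝ (Fin m)) 1, ∑ l, Y k ^ 2 * Y l ^ 2
        = m * (a / 3) + 2 * a / 3 := by
    intro k
    rw [integral_finsetSum _ fun j _ => integrableOn_closedBall (by fun_prop)]
    simp_rw [hkl]
    simp [Finset.sum_add_distrib]
  simp_rw [h6] at h1
  have hm0 : (m : ℝ) ≠ 0 := by positivity
  simp only [Finset.sum_const, Finset.card_univ, Fintype.card_fin, nsmul_eq_mul] at h1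
  have h7 : a = 3 * (volume.real (Metric.closedBall (0 : EuclideanSpace ℝ (Fin m)) 1)
      / ((m + 2) * (m + 4))) := by
    field_simp at h1 ⊢
    push_cast at h1
    linarith
  rw [hkl]
  split_ifs
  · rw [h7]; ring
  · rw [h7]; ring

end Moments

/-! ### Moments of the half ball and of the disk -/

section HalfBall

variable {n : ℕ}

theorem preimage_upperHalfBall (μ : Fin n) :
    coordReflection μ.castSucc ⁻¹' upperHalfBall n = upperHalfBall n := by
  ext Y
  have h := coordReflection_of_ne (Fin.castSucc_lt_last μ).ne' Y
  simp [upperHalfBall, h]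

/-- The equatorial hyperplane is null, being a layer of thickness zero. -/
theorem volume_equator :
    volume {Y : EuclideanSpace ℝ (Fin (n + 1)) | Y (Fin.last n) = 0} = 0 := by
  have h := volume_layer (n := n) MeasurableSet.univ (measurable_const (a := (0 : ℝ))) 0
  have h2 : {Y : EuclideanSpace ℝ (Fin (n + 1)) | Y (Fin.last n) = 0}
      = layer Set.univ (fun _ => 0) 0 := by
    ext Y
    simp [layer]
  rw [h2, h]
  simp

theorem setIntegral_upperHalfBall_of_even {g : EuclideanSpace ℝ (Fin (n + 1)) → ℝ}
    (hg : Continuous g) (heven : ∀ Y, g (coordReflection (Fin.last n) Y) = g Y) :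
    ∫ Y in upperHalfBall n, g Y
      = 1 / 2 * ∫ Y in Metric.closedBall (0 : EuclideanSpace ℝ (Fin (n + 1))) 1, g Y := by
  set σ := coordReflection (Fin.last n) with hσ
  have hσm : MeasurableSet (σ ⁻¹' upperHalfBall n) :=
    σ.continuous.measurable measurableSet_upperHalfBall
  have h1 : ∫ Y in σ ⁻¹' upperHalfBall n, g Y = ∫ Y in upperHalfBall n, g Y := by
    have := σ.measurePreserving.setIntegral_preimage_emb
      σ.toHomeomorph.measurableEmbedding g (upperHalfBall n)
    rw [← this]
    simp_rw [heven]
  have hlast : ∀ Y, σ Y (Fin.last n) = -Y (Fin.last n) := coordReflection_self _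
  have h2 : (upperHalfBall n ∪ σ ⁻¹' upperHalfBall n : Set _)
      =ᵐ[volume] Metric.closedBall (0 : EuclideanSpace ℝ (Fin (n + 1))) 1 := by
    have h3 : ∀ᵐ Y : EuclideanSpace ℝ (Fin (n + 1)), Y (Fin.last n) ≠ 0 := by
      rw [ae_iff]
      simpa using volume_equator
    filter_upwards [h3] with Y hY
    refine propext ⟨?_, fun h => ?_⟩
    · rintro (h | h)
      · exact h.1
      · have : σ Y ∈ Metric.closedBall (0 : EuclideanSpace ℝ (Fin (n + 1))) 1 := h.1
        rwa [← preimage_closedBall_zero σ]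
    · rcases hY.lt_or_gt with h0 | h0
      · refine Or.inr ⟨?_, by rw [hlast]; linarith⟩
        rw [← preimage_closedBall_zero σ] at h
        exact h
      · exact Or.inl ⟨h, h0⟩
  have hdisj : Disjoint (upperHalfBall n) (σ ⁻¹' upperHalfBall n) := by
    refine Set.disjoint_left.2 fun Y hY hY' => ?_
    have h3 : 0 < σ Y (Fin.last n) := hY'.2
    rw [hlast] at h3
    linarith [hY.2]
  have hi := integrableOn_closedBall hg
  rw [← setIntegral_congr_set h2, setIntegral_union hdisj hσm
    (hi.mono_set fun Y hY => hY.1)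
    (hi.mono_set fun Y hY => by
      rw [← preimage_closedBall_zero σ]
      exact hY.1), h1]
  ring

theorem integral_height_pos : 0 < ∫ Y in upperHalfBall n, Y (Fin.last n) := by
  rw [setIntegral_pos_iff_support_of_nonneg_ae]
  · have hop : IsOpen {Y : EuclideanSpace ℝ (Fin (n + 1)) |
        Y ∈ Metric.ball 0 1 ∧ 0 < Y (Fin.last n)} :=
      Metric.isOpen_ball.inter (isOpen_lt (f := fun _ => (0 : ℝ))
        (g := fun Y : EuclideanSpace ℝ (Fin (n + 1)) => Y (Fin.last n))
        continuous_const (by fun_prop))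
    refine (hop.measure_pos volume ⟨EuclideanSpace.single (Fin.last n) (1 / 2 : ℝ), ?_, ?_⟩).trans_le
      (measure_mono fun Y hY => ⟨?_, Metric.ball_subset_closedBall hY.1, hY.2⟩)
    · simp
      norm_num
    · simp
    · exact (hY.2 : 0 < Y (Fin.last n)).ne'
  · exact (ae_restrict_iff' measurableSet_upperHalfBall).2 (Eventually.of_forall fun Y hY => hY.2.le)
  · exact (integrableOn_closedBall (by fun_prop)).mono_set fun Y hY => hY.1

end HalfBall

section Asymptotics

variable {n : ℕ}

theorem continuous_osculating (κ : Fin n → ℝ) :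
    Continuous fun y : EuclideanSpace ℝ (Fin n) => osculating κ y := by
  unfold osculating
  fun_prop

/-- `abs_integral_sub_add_le` for a paraboloidal cap, with a constant that does not depend on `ε`, the
cap or the integrand. -/
theorem exists_moment_bound (κ : Fin n → ℝ) {C : ℝ} (hC : 0 < C) :
    ∃ K ε₀ : ℝ, 0 < K ∧ 0 < ε₀ ∧ ∀ ε D, 0 < ε → ε < ε₀ → IsParaboloidalCap κ C ε D →
      ∀ (ψ : EuclideanSpace ℝ (Fin (n + 1)) → ℝ) (ψ₀ : EuclideanSpace ℝ (Fin n) → ℝ),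
      Continuous ψ → Continuous ψ₀ → (∀ Y, ‖Y‖ ≤ 1 → |ψ Y| ≤ 1) → (∀ y, ‖y‖ ≤ 1 → |ψ₀ y| ≤ 1) →
      (∀ Y, ‖Y‖ ≤ 1 → |ψ Y - ψ₀ (horiz Y)| ≤ |Y (Fin.last n)|) →
      |(∫ Y in D, ψ Y) - ((∫ Y in upperHalfBall n, ψ Y)
        - ε * ∫ y in Metric.closedBall (0 : EuclideanSpace ℝ (Fin n)) 1, osculating κ y * ψ₀ y)|
        ≤ K * ε ^ 2 := by
  set Q := 1 / 2 * ∑ i, |κ i| with hQ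
  have hQ0 : 0 ≤ Q := by positivity
  set V := volume.real (Metric.closedBall (0 : EuclideanSpace ℝ (Fin n)) 1) with hV
  have hV0 : 0 ≤ V := measureReal_nonneg
  refine ⟨V * (2 * C + (2 + 2 * n) * Q ^ 2) + 1, 1 / (Q + 1), by positivity, by positivity,
    fun ε D hε hεlt hD ψ ψ₀ hψ hψ₀ hψ1 hψ₀1 hψψ₀ => ?_⟩
  have hεQ : ε * Q ≤ 1 := by
    rw [lt_div_iff₀ (by positivity)] at hεlt
    nlinarith
  have h := abs_integral_sub_add_le (a := fun y => ε * osculating κ y) (c := ε * Q)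
    (w := C * ε ^ 2) ((continuous_const.mul (continuous_osculating κ)).measurable) (by positivity) hεQ
    (by positivity) (fun y hy => ?_) hD.measurable hD.subset hD.above hψ.measurable
    (fun Y hY => hψ1 Y (mem_closedBall_zero_iff.1 hY)) hψ₀.measurable
    (fun Y hY => hψ₀1 Y (mem_closedBall_zero_iff.1 hY))
    (fun Y hY => hψψ₀ Y (mem_closedBall_zero_iff.1 hY))
  · simp_rw [mul_assoc, integral_const_mul] at h
    rw [← sub_add]
    refine h.trans ?_
    rw [← hV]
    nlinarith [sq_nonneg ε]
  · rw [abs_mul, abs_of_pos hε]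
    gcongr
    exact abs_osculating_le κ fun i =>
      (abs_coord_le_norm y i).trans (mem_closedBall_zero_iff.1 hy)

theorem integral_osculating (hn : 1 ≤ n) (κ : Fin n → ℝ) :
    ∫ y in Metric.closedBall (0 : EuclideanSpace ℝ (Fin n)) 1, osculating κ y
      = volume.real (Metric.closedBall (0 : EuclideanSpace ℝ (Fin n)) 1) / (2 * (n + 2))
        * ∑ μ, κ μ := by
  simp only [osculating]
  rw [integral_const_mul, integral_finsetSum _ fun j _ => integrableOn_closedBall (by fun_prop)]
  simp_rw [integral_const_mul, integral_sq hn]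
  rw [← Finset.sum_mul]
  field_simp

/-- The fourth moments `m₄ = 3 m₂₂` of the disk turn `∑ κ_ν y_ν²` into `∑ κ_ν + 2 κ_μ`. -/
theorem integral_osculating_mul_sq (hn : 1 ≤ n) (κ : Fin n → ℝ) (μ : Fin n) :
    ∫ y in Metric.closedBall (0 : EuclideanSpace ℝ (Fin n)) 1, osculating κ y * (y μ * y μ)
      = volume.real (Metric.closedBall (0 : EuclideanSpace ℝ (Fin n)) 1) / (2 * (n + 2) * (n + 4))
        * (∑ ν, κ ν + 2 * κ μ) := by
  have h : ∀ y : EuclideanSpace ℝ (Fin n), osculating κ y * (y μ * y μ)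
      = 1 / 2 * ∑ ν, κ ν * (y ν ^ 2 * y μ ^ 2) := by
    intro y
    rw [osculating, mul_assoc, Finset.sum_mul]
    congr 1
    exact Finset.sum_congr rfl fun ν _ => by ring
  simp_rw [h]
  rw [integral_const_mul, integral_finsetSum _ fun j _ => integrableOn_closedBall (by fun_prop)]
  simp_rw [integral_const_mul, integral_sq_mul_sq hn]
  have h2 : ∀ ν, κ ν * ((if ν = μ then 3 else 1) *
      (volume.real (Metric.closedBall (0 : EuclideanSpace ℝ (Fin n)) 1) / ((n + 2) * (n + 4))))
      = (κ ν + if ν = μ then 2 * κ ν else 0) *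
      (volume.real (Metric.closedBall (0 : EuclideanSpace ℝ (Fin n)) 1) / ((n + 2) * (n + 4))) := by
    intro ν
    split_ifs <;> ring
  simp_rw [h2]
  rw [← Finset.sum_mul, Finset.sum_add_distrib]
  simp only [Finset.sum_ite_eq', Finset.mem_univ, if_true]
  field_simp

theorem osculating_coordReflection (κ : Fin n → ℝ) (μ : Fin n) (y : EuclideanSpace ℝ (Fin n)) :
    osculating κ (coordReflection μ y) = osculating κ y := by
  simp only [osculating]
  congr 1
  refine Finset.sum_congr rfl fun ν _ => ?_
  by_cases h : ν = μ
  · subst h; rw [coordReflection_self]; ring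
  · rw [coordReflection_of_ne h]

end Asymptotics

/-! ### The covariance matrix of a paraboloidal cap -/

section Covariance

variable {n : ℕ}

theorem ballVol_one (m : ℕ) :
    ballVol m 1 = volume.real (Metric.closedBall (0 : EuclideanSpace ℝ (Fin m)) 1) := rfl

theorem ballVol_one_pos (m : ℕ) : 0 < ballVol m 1 := by
  rw [ballVol_one]
  exact ENNReal.toReal_pos (Metric.measure_closedBall_pos volume _ one_pos).ne'
    measure_closedBall_lt_top.ne

/-- The volume, the first and the second moments of a paraboloidal cap, up to `O(ε²)`. -/
theorem exists_moments_cap (hn : 1 ≤ n) (κ : Fin n → ℝ) {C : ℝ} (hC : 0 < C) :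
    ∃ K ε₀ : ℝ, 0 < K ∧ 0 < ε₀ ∧ ∀ ε D, 0 < ε → ε < ε₀ → IsParaboloidalCap κ C ε D →
      |vol D - (ballVol (n + 1) 1 / 2 - ε * (ballVol n 1 / (2 * (n + 2)) * ∑ μ, κ μ))|
        ≤ K * ε ^ 2 ∧
      (∀ μ : Fin n, |∫ Y in D, Y μ.castSucc| ≤ K * ε ^ 2) ∧
      |(∫ Y in D, Y (Fin.last n)) - ∫ Y in upperHalfBall n, Y (Fin.last n)| ≤ K * ε ^ 2 ∧
      (∀ μ : Fin n, |(∫ Y in D, Y μ.castSucc * Y μ.castSucc) - (ballVol (n + 1) 1 / (2 * (n + 3))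
        - ε * (ballVol n 1 / (2 * (n + 2) * (n + 4)) * (∑ ν, κ ν + 2 * κ μ)))| ≤ K * ε ^ 2) ∧
      (∀ (μ : Fin n) (j : Fin (n + 1)), j ≠ μ.castSucc →
        |∫ Y in D, Y μ.castSucc * Y j| ≤ K * ε ^ 2) ∧
      |(∫ Y in D, Y (Fin.last n) * Y (Fin.last n)) - ballVol (n + 1) 1 / (2 * (n + 3))|
        ≤ K * ε ^ 2 := by
  obtain ⟨K, ε₀, hK, hε₀, h⟩ := exists_moment_bound κ hC
  refine ⟨K, ε₀, hK, hε₀, fun ε D hε hεlt hD => ?_⟩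
  have h := h ε D hε hεlt hD
  have hle : ∀ {m : ℕ} {Y : EuclideanSpace ℝ (Fin m)}, ‖Y‖ ≤ 1 → ∀ i, |Y i| ≤ 1 :=
    fun hY i => (abs_coord_le_norm _ i).trans hY
  have hle2 : ∀ {m : ℕ} {Y : EuclideanSpace ℝ (Fin m)}, ‖Y‖ ≤ 1 → ∀ i j, |Y i * Y j| ≤ 1 :=
    fun hY i j => by
      rw [abs_mul]; exact mul_le_one₀ (hle hY i) (abs_nonneg _) (hle hY j)
  have hsqH : ∀ i : Fin (n + 1), ∫ Y in upperHalfBall n, Y i * Y i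
      = ballVol (n + 1) 1 / (2 * (n + 3)) := by
    intro i
    rw [setIntegral_upperHalfBall_of_even (by fun_prop)]
    · have := integral_sq (m := n + 1) (by omega) i
      simp_rw [← pow_two]
      rw [this, ballVol_one]
      push_cast
      field_simp
      ring
    · intro Y
      by_cases hi : i = Fin.last n
      · subst hi; rw [coordReflection_self]; ring
      · rw [coordReflection_of_ne hi]
  have hodd1 : ∀ μ : Fin n, ∫ Y in upperHalfBall n, Y μ.castSucc = 0 := fun μ =>
    setIntegral_eq_zero_of_odd μ.castSucc (preimage_upperHalfBall μ) fun Y =>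
      coordReflection_self _ _
  have hodd2 : ∀ (μ : Fin n) (j : Fin (n + 1)), j ≠ μ.castSucc →
      ∫ Y in upperHalfBall n, Y μ.castSucc * Y j = 0 := fun μ j hj =>
    setIntegral_eq_zero_of_odd μ.castSucc (preimage_upperHalfBall μ) fun Y => by
      rw [coordReflection_self, coordReflection_of_ne hj]; ring
  refine ⟨?_, fun μ => ?_, ?_, fun μ => ?_, fun μ j hj => ?_, ?_⟩
  · have h1 := h (fun _ => 1) (fun _ => 1) continuous_const continuous_const (by simp) (by simp)
      (by simp)
    rw [setIntegral_upperHalfBall_of_even continuous_const (fun _ => rfl)] at h1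
    simp only [mul_one, integral_osculating hn] at h1
    simp only [setIntegral_const, smul_eq_mul, mul_one] at h1
    rw [← ballVol_one, ← ballVol_one] at h1
    convert! h1 using 2
    rw [vol, measureReal_def]
    ring
  · have h1 := h (fun Y => Y μ.castSucc) (fun y => y μ) (by fun_prop) (by fun_prop)
      (fun Y hY => hle hY _) (fun Y hY => hle hY _) (by simp)
    have h2 : ∫ y in Metric.closedBall (0 : EuclideanSpace ℝ (Fin n)) 1, osculating κ y * y μ = 0 :=
      setIntegral_eq_zero_of_odd μ (preimage_closedBall_zero _) fun Y => by
        rw [osculating_coordReflection, coordReflection_self]; ring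
    simpa [h2, hodd1] using h1
  · have h1 := h (fun Y => Y (Fin.last n)) (fun y => 0) (by fun_prop) (by fun_prop)
      (fun Y hY => hle hY _) (by simp) (by simp)
    simpa using h1
  · have h1 := h (fun Y => Y μ.castSucc * Y μ.castSucc) (fun y => y μ * y μ) (by fun_prop)
      (by fun_prop) (fun Y hY => hle2 hY _ _) (fun Y hY => hle2 hY _ _) (by simp)
    rw [hsqH, integral_osculating_mul_sq hn, ← ballVol_one] at h1
    exact h1
  · induction j using Fin.lastCases with
    | last =>
      have h1 := h (fun Y => Y μ.castSucc * Y (Fin.last n)) (fun y => 0) (by fun_prop)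
        (by fun_prop) (fun Y hY => hle2 hY _ _) (by simp) (fun Y hY => by
          rw [sub_zero, abs_mul]
          exact mul_le_of_le_one_left (abs_nonneg _) (hle hY _))
      simpa [hodd2 μ _ hj] using h1
    | cast ν =>
      have hνμ : ν ≠ μ := fun h => hj (by rw [h])
      have h1 := h (fun Y => Y μ.castSucc * Y ν.castSucc) (fun y => y μ * y ν) (by fun_prop)
        (by fun_prop) (fun Y hY => hle2 hY _ _) (fun Y hY => hle2 hY _ _) (by simp)
      have h2 : ∫ y in Metric.closedBall (0 : EuclideanSpace ℝ (Fin n)) 1,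
          osculating κ y * (y μ * y ν) = 0 :=
        setIntegral_eq_zero_of_odd μ (preimage_closedBall_zero _) fun Y => by
          rw [osculating_coordReflection, coordReflection_self, coordReflection_of_ne hνμ]; ring
      simpa [h2, hodd2 μ _ hj] using h1
  · have h1 := h (fun Y => Y (Fin.last n) * Y (Fin.last n)) (fun y => 0) (by fun_prop)
      (by fun_prop) (fun Y hY => hle2 hY _ _) (by simp) (fun Y hY => by
        rw [sub_zero, abs_mul]
        exact mul_le_of_le_one_left (abs_nonneg _) (hle hY _))
    simpa [hsqH] using h1

theorem barycenter_apply {m : ℕ} {D : Set (EuclideanSpace ℝ (Fin m))}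
    (hD : D ⊆ Metric.closedBall 0 1) (i : Fin m) :
    barycenter D i = (vol D)⁻¹ * ∫ Y in D, Y i := by
  have hi : IntegrableOn (fun Y : EuclideanSpace ℝ (Fin m) => Y) D :=
    (continuous_id.continuousOn.integrableOn_compact (isCompact_closedBall 0 1)).mono_set hD
  have h := (EuclideanSpace.proj i : EuclideanSpace ℝ (Fin m) →L[ℝ] ℝ).integral_comp_comm hi
  simp only [PiLp.proj_apply] at h
  rw [barycenter, PiLp.smul_apply, smul_eq_mul, h]

theorem covMatrix_apply {m : ℕ} {D : Set (EuclideanSpace ℝ (Fin m))}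
    (hD : D ⊆ Metric.closedBall 0 1) (hv : vol D ≠ 0) (i j : Fin m) :
    covMatrix D i j = (∫ Y in D, Y i * Y j) - (∫ Y in D, Y i) * (∫ Y in D, Y j) / vol D := by
  have hi : ∀ g : EuclideanSpace ℝ (Fin m) → ℝ, Continuous g → IntegrableOn g D :=
    fun g hg => (integrableOn_closedBall hg).mono_set hD
  rw [covMatrix, Matrix.of_apply]
  have h1 : ∀ Y : EuclideanSpace ℝ (Fin m),
      (Y i - barycenter D i) * (Y j - barycenter D j)
        = Y i * Y j - barycenter D j * Y i - barycenter D i * Y j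
          + barycenter D i * barycenter D j := fun Y => by ring
  simp_rw [h1]
  rw [integral_add (hi _ (by fun_prop)) (hi _ (by fun_prop)),
    integral_sub (hi _ (by fun_prop)) (hi _ (by fun_prop)),
    integral_sub (hi _ (by fun_prop)) (hi _ (by fun_prop)), integral_const_mul,
    integral_const_mul, setIntegral_const, barycenter_apply hD, barycenter_apply hD,
    smul_eq_mul]
  rw [show volume.real D = vol D from rfl]
  field_simp
  ring

theorem covMatrix_comm {m : ℕ} (D : Set (EuclideanSpace ℝ (Fin m))) (i j : Fin m) :
    covMatrix D i j = covMatrix D j i := by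
  simp only [covMatrix, Matrix.of_apply, mul_comm]

/-- The diagonal of the limiting covariance matrix: the values in the principal directions, and a
value `d` in the normal direction. -/
noncomputable def limitDiag (κ : Fin n → ℝ) (ε d : ℝ) : Fin (n + 1) → ℝ :=
  Fin.snoc (fun μ => ballVol (n + 1) 1 / (2 * (n + 3))
    - ε * (ballVol n 1 / (2 * (n + 2) * (n + 4)) * (∑ ν, κ ν + 2 * κ μ))) d

/-- The covariance matrix of a cap is diagonal up to `O(ε²)`. The displacement of the barycenter in
the normal direction separates the last diagonal entry from the others by a fixed amount. -/
theorem exists_covMatrix_cap (hn : 1 ≤ n) (κ : Fin n → ℝ) {C : ℝ} (hC : 0 < C) :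
    ∃ K g ε₀ : ℝ, 0 < K ∧ 0 < g ∧ 0 < ε₀ ∧
      ∀ ε D, 0 < ε → ε < ε₀ → IsParaboloidalCap κ C ε D →
      |vol D - (ballVol (n + 1) 1 / 2 - ε * (ballVol n 1 / (2 * (n + 2)) * ∑ μ, κ μ))|
        ≤ K * ε ^ 2 ∧
      ∃ d ≤ ballVol (n + 1) 1 / (2 * (n + 3)) - g,
        ∀ i j, |(covMatrix D - Matrix.diagonal (limitDiag κ ε d)) i j| ≤ K * ε ^ 2 := by
  obtain ⟨K, ε₀, hK, hε₀, h⟩ := exists_moments_cap hn κ hC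
  set W := ballVol (n + 1) 1 with hW
  have hW0 : 0 < W := ballVol_one_pos _
  set c₁ := ∫ Y in upperHalfBall n, Y (Fin.last n) with hc₁
  have hc₁0 : 0 < c₁ := integral_height_pos
  set P := ballVol n 1 / (2 * (n + 2)) * ∑ μ, κ μ with hP
  set A := W / (2 * (n + 3)) with hA
  set K' := K + K * (K + c₁) * (4 / W) with hK'
  have hK'0 : 0 < K' := by positivity
  refine ⟨K', c₁ ^ 2 / (8 * W),
    min (min ε₀ 1) (min (W / (4 * (|P| + K))) (min (c₁ / (2 * K)) (c₁ ^ 2 / (8 * W * K)))),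
    hK'0, by positivity, by positivity, fun ε D hε hεlt hD => ?_⟩
  simp only [lt_min_iff] at hεlt
  obtain ⟨⟨hε1, hε2⟩, hε3, hε4, hε5⟩ := hεlt
  obtain ⟨m0, m1, m2, m3, m4, m5⟩ := h ε D hε hε1 hD
  rw [lt_div_iff₀ (by positivity)] at hε3 hε4 hε5
  have hεε : K * ε ^ 2 ≤ K * ε := by gcongr; nlinarith
  have hKK' : K * ε ^ 2 ≤ K' * ε ^ 2 := by
    gcongr
    rw [hK']
    have : 0 ≤ K * (K + c₁) * (4 / W) := by positivity
    linarith
  have hvW : vol D ≤ W := by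
    rw [hW, ballVol_one]
    exact measureReal_mono hD.subset measure_closedBall_lt_top.ne
  have hv : W / 4 ≤ vol D := by
    have h1 := (abs_le.1 m0).1
    have h2 : ε * P ≤ ε * |P| := by gcongr; exact le_abs_self P
    nlinarith
  have hv0 : 0 < vol D := by linarith [div_pos hW0 (by norm_num : (0 : ℝ) < 4)]
  have hcov := covMatrix_apply hD.subset hv0.ne'
  have m2' : |∫ Y in D, Y (Fin.last n)| ≤ K + c₁ := by
    have h1 := abs_le.1 m2
    have h2 : K * ε ≤ K := by nlinarith
    exact abs_le.2 ⟨by linarith [h1.1], by linarith [h1.2]⟩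
  have m1' : ∀ j : Fin (n + 1), |∫ Y in D, Y j| ≤ K + c₁ := by
    intro j
    induction j using Fin.lastCases with
    | last => exact m2'
    | cast ν =>
      have h2 : K * ε ≤ K := by nlinarith
      linarith [m1 ν]
  have hprod : ∀ (μ : Fin n) (j : Fin (n + 1)),
      |(∫ Y in D, Y μ.castSucc) * (∫ Y in D, Y j) / vol D|
        ≤ K * (K + c₁) * (4 / W) * ε ^ 2 := by
    intro μ j
    rw [abs_div, abs_mul, abs_of_pos hv0]
    have h1 : |∫ Y in D, Y μ.castSucc| * |∫ Y in D, Y j| ≤ K * ε ^ 2 * (K + c₁) :=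
      mul_le_mul (m1 μ) (m1' j) (abs_nonneg _) (by positivity)
    calc _ ≤ K * ε ^ 2 * (K + c₁) / (W / 4) := by gcongr
      _ = _ := by field_simp
  have hoff : ∀ (μ : Fin n) (j : Fin (n + 1)), j ≠ μ.castSucc →
      |covMatrix D μ.castSucc j| ≤ K' * ε ^ 2 := by
    intro μ j hj
    rw [hcov]
    refine (abs_sub _ _).trans ?_
    rw [hK', add_mul]
    exact add_le_add (m4 μ j hj) (hprod μ j)
  refine ⟨m0.trans hKK', covMatrix D (Fin.last n) (Fin.last n), ?_, fun i j => ?_⟩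
  · -- `∫ Y_{n+1}²` is `W / (2 (n + 3)) + O(ε²)`, and `(∫ Y_{n+1})² / vol D ≥ c₁² / (4 W)`.
    rw [hcov]
    have h1 : c₁ / 2 ≤ ∫ Y in D, Y (Fin.last n) := by
      have h2 := (abs_le.1 m2).1
      linarith
    have h0 : 0 ≤ ∫ Y in D, Y (Fin.last n) := by linarith
    have h3 : (c₁ / 2) * (c₁ / 2) / W
        ≤ (∫ Y in D, Y (Fin.last n)) * (∫ Y in D, Y (Fin.last n)) / vol D := by
      gcongr
    have h4 : K * ε ≤ c₁ ^ 2 / (8 * W) := by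
      rw [le_div_iff₀ (by positivity)]
      linarith
    have h5 : (c₁ / 2) * (c₁ / 2) / W = 2 * (c₁ ^ 2 / (8 * W)) := by field_simp; ring
    have h6 := (abs_le.1 m5).2
    linarith
  · rw [Matrix.sub_apply]
    induction i using Fin.lastCases with
    | last =>
      induction j using Fin.lastCases with
      | last =>
        rw [Matrix.diagonal_apply_eq, limitDiag, Fin.snoc_last, sub_self, abs_zero]
        positivity
      | cast ν =>
        rw [Matrix.diagonal_apply_ne _ (Fin.castSucc_lt_last ν).ne', sub_zero, covMatrix_comm]
        exact hoff ν _ (Fin.castSucc_lt_last ν).ne'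
    | cast μ =>
      by_cases hj : j = μ.castSucc
      · subst hj
        rw [Matrix.diagonal_apply_eq, limitDiag, Fin.snoc_castSucc, hcov, sub_right_comm]
        refine (abs_sub _ _).trans ?_
        rw [hK', add_mul]
        exact add_le_add (m3 μ) (hprod μ _)
      · rw [Matrix.diagonal_apply_ne _ (Ne.symm hj), sub_zero]
        exact hoff μ j hj

end Covariance

/-! ### Perturbation of eigenvalues and eigenvectors -/

section Perturbation

variable {m : ℕ}

/-- Monotonicity of the sorted eigenvalues in the quadratic form. The `m - 1` linear conditions
`⟨b_i, v⟩ = 0` for `i > k` and `⟨c_i, v⟩ = 0` for `i < k` have a nonzero solution `v`, and the two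
forms are compared at `v`. -/
theorem le_add_of_quadratic_le {β γ : Fin m → ℝ} (hβ : Antitone β) (hγ : Antitone γ)
    (b c : OrthonormalBasis (Fin m) ℝ (EuclideanSpace ℝ (Fin m))) {η : ℝ}
    (h : ∀ v, ∑ i, β i * inner ℝ (b i) v ^ 2 ≤ ∑ i, γ i * inner ℝ (c i) v ^ 2 + η * ‖v‖ ^ 2)
    (k : Fin m) : β k ≤ γ k + η := by
  let L : EuclideanSpace ℝ (Fin m) →ₗ[ℝ] ({j // j ≠ k} → ℝ) :=
    LinearMap.pi fun j => if j.1 < k then (innerSL ℝ (c j)).toLinearMap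
      else (innerSL ℝ (b j)).toLinearMap
  have hker : LinearMap.ker L ≠ ⊥ := by
    refine LinearMap.ker_ne_bot_of_finrank_lt ?_
    have hm : 0 < m := k.pos
    simp [Fintype.card_subtype_compl]
    omega
  obtain ⟨v, hvL, hv0⟩ := Submodule.exists_mem_ne_zero_of_ne_bot hker
  have hvj : ∀ j (hj : j ≠ k), L v ⟨j, hj⟩ = 0 := fun j hj => by
    rw [LinearMap.mem_ker.1 hvL]; rfl
  have hc : ∀ j, j < k → inner ℝ (c j) v = 0 := fun j hj => by
    simpa [L, hj] using hvj j hj.ne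
  have hb : ∀ j, k < j → inner ℝ (b j) v = 0 := fun j hj => by
    simpa [L, hj.not_gt] using hvj j hj.ne'
  have h1 : β k * ‖v‖ ^ 2 ≤ ∑ i, β i * inner ℝ (b i) v ^ 2 := by
    rw [← b.sum_sq_inner_right v, Finset.mul_sum]
    refine Finset.sum_le_sum fun i _ => ?_
    rcases le_or_gt i k with hi | hi
    · exact mul_le_mul_of_nonneg_right (hβ hi) (sq_nonneg _)
    · simp [hb i hi]
  have h2 : ∑ i, γ i * inner ℝ (c i) v ^ 2 ≤ γ k * ‖v‖ ^ 2 := by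
    rw [← c.sum_sq_inner_right v, Finset.mul_sum]
    refine Finset.sum_le_sum fun i _ => ?_
    rcases lt_or_ge i k with hi | hi
    · simp [hc i hi]
    · exact mul_le_mul_of_nonneg_right (hγ hi) (sq_nonneg _)
  have hv : 0 < ‖v‖ ^ 2 := by positivity
  refine le_of_mul_le_mul_right ?_ hv
  linarith [h v]

theorem dotProduct_mulVec_eq_sum {M : Matrix (Fin m) (Fin m) ℝ} {lam : Fin m → ℝ}
    {c : OrthonormalBasis (Fin m) ℝ (EuclideanSpace ℝ (Fin m))}
    (hc : IsEigenDecomposition M lam c) (v : EuclideanSpace ℝ (Fin m)) :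
    v.ofLp ⬝ᵥ (M *ᵥ v.ofLp) = ∑ i, lam i * inner ℝ (c i) v ^ 2 := by
  have h1 : v.ofLp = ∑ i, inner ℝ (c i) v • (c i).ofLp := by
    conv_lhs => rw [← c.sum_repr' v]
    simp
  have h2 : M *ᵥ v.ofLp = ∑ i, (inner ℝ (c i) v * lam i) • (c i).ofLp := by
    conv_lhs => rw [h1]
    rw [Matrix.mulVec_sum]
    refine Finset.sum_congr rfl fun i _ => ?_
    rw [Matrix.mulVec_smul, hc.2, smul_smul]
  rw [h2, dotProduct_sum]
  refine Finset.sum_congr rfl fun i _ => ?_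
  have h3 : v.ofLp ⬝ᵥ (c i).ofLp = inner ℝ (c i) v := by
    rw [EuclideanSpace.inner_eq_star_dotProduct]
    simp
  rw [dotProduct_smul, h3, smul_eq_mul]
  ring

theorem abs_mulVec_le {E : Matrix (Fin m) (Fin m) ℝ} {δ : ℝ} (hE : ∀ i j, |E i j| ≤ δ)
    (v : EuclideanSpace ℝ (Fin m)) (i : Fin m) : |(E *ᵥ v.ofLp) i| ≤ m * δ * ‖v‖ := by
  have hδ : 0 ≤ δ := (abs_nonneg _).trans (hE i i)
  rw [Matrix.mulVec, dotProduct]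
  calc |∑ j, E i j * v j| ≤ ∑ j, |E i j * v j| := Finset.abs_sum_le_sum_abs _ _
    _ ≤ ∑ _j : Fin m, δ * ‖v‖ := by
        refine Finset.sum_le_sum fun j _ => ?_
        rw [abs_mul]
        exact mul_le_mul (hE i j) (abs_coord_le_norm v j) (abs_nonneg _) hδ
    _ = m * δ * ‖v‖ := by simp [mul_assoc]

theorem abs_dotProduct_mulVec_le {E : Matrix (Fin m) (Fin m) ℝ} {δ : ℝ}
    (hE : ∀ i j, |E i j| ≤ δ) (v : EuclideanSpace ℝ (Fin m)) :
    |v.ofLp ⬝ᵥ (E *ᵥ v.ofLp)| ≤ m * (m * δ) * ‖v‖ ^ 2 := by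
  rw [dotProduct]
  calc |∑ i, v i * (E *ᵥ v.ofLp) i| ≤ ∑ i, |v i * (E *ᵥ v.ofLp) i| := Finset.abs_sum_le_sum_abs _ _
    _ ≤ ∑ _i : Fin m, ‖v‖ * (m * δ * ‖v‖) := by
        refine Finset.sum_le_sum fun i _ => ?_
        rw [abs_mul]
        exact mul_le_mul (abs_coord_le_norm v i) (abs_mulVec_le hE v i) (abs_nonneg _)
          (norm_nonneg _)
    _ = m * (m * δ) * ‖v‖ ^ 2 := by simp; ring

theorem isEigenDecomposition_diagonal {Λ : Fin m → ℝ} (hΛ : Antitone Λ) :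
    IsEigenDecomposition (Matrix.diagonal Λ) Λ (EuclideanSpace.basisFun (Fin m) ℝ) := by
  refine ⟨hΛ, fun i => ?_⟩
  ext j
  by_cases h : j = i
  · subst h; simp [Matrix.mulVec_diagonal]
  · simp [Matrix.mulVec_diagonal, h]

/-- Weyl's inequality, in the crude form that is enough here. -/
theorem abs_eigenvalue_sub_le {M : Matrix (Fin m) (Fin m) ℝ} {lam Λ : Fin m → ℝ}
    {c : OrthonormalBasis (Fin m) ℝ (EuclideanSpace ℝ (Fin m))} {δ : ℝ}
    (hc : IsEigenDecomposition M lam c) (hΛ : Antitone Λ)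
    (hE : ∀ i j, |(M - Matrix.diagonal Λ) i j| ≤ δ) (k : Fin m) :
    |lam k - Λ k| ≤ m * (m * δ) := by
  have hd := isEigenDecomposition_diagonal hΛ
  have h : ∀ v : EuclideanSpace ℝ (Fin m),
      |(∑ i, lam i * inner ℝ (c i) v ^ 2)
        - ∑ i, Λ i * inner ℝ (EuclideanSpace.basisFun (Fin m) ℝ i) v ^ 2|
        ≤ m * (m * δ) * ‖v‖ ^ 2 := by
    intro v
    rw [← dotProduct_mulVec_eq_sum hc, ← dotProduct_mulVec_eq_sum hd, ← dotProduct_sub,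
      ← Matrix.sub_mulVec]
    exact abs_dotProduct_mulVec_le hE v
  have h1 := le_add_of_quadratic_le hc.1 hΛ c (EuclideanSpace.basisFun (Fin m) ℝ)
    (η := m * (m * δ)) (fun v => by linarith [(abs_le.1 (h v)).2]) k
  have h2 := le_add_of_quadratic_le hΛ hc.1 (EuclideanSpace.basisFun (Fin m) ℝ) c
    (η := m * (m * δ)) (fun v => by linarith [(abs_le.1 (h v)).1]) k
  exact abs_le.2 ⟨by linarith, by linarith⟩

/-- An eigenvector has small components along the coordinate directions whose diagonal entry is far
from its own. -/
theorem abs_sub_mul_abs_eigenvector_le {M : Matrix (Fin m) (Fin m) ℝ} {lam Λ : Fin m → ℝ}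
    {c : OrthonormalBasis (Fin m) ℝ (EuclideanSpace ℝ (Fin m))} {δ : ℝ}
    (hc : IsEigenDecomposition M lam c) (hΛ : Antitone Λ)
    (hE : ∀ i j, |(M - Matrix.diagonal Λ) i j| ≤ δ) (i k : Fin m) :
    |Λ i - Λ k| * |c k i| ≤ 2 * (m * (m * δ)) := by
  have hδ : 0 ≤ δ := (abs_nonneg _).trans (hE i i)
  have hm : (1 : ℝ) ≤ m := by exact_mod_cast k.pos
  have h1 := abs_eigenvalue_sub_le hc hΛ hE k
  have hck : ‖c k‖ = 1 := c.norm_eq_one k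
  have h2 := abs_mulVec_le hE (c k) i
  rw [hck, mul_one, Matrix.sub_mulVec, hc.2, Pi.sub_apply, Matrix.mulVec_diagonal,
    Pi.smul_apply, smul_eq_mul] at h2
  have h3 : |c k i| ≤ 1 := (abs_coord_le_norm _ i).trans hck.le
  have h4 : |Λ i - Λ k| * |c k i|
      = |(lam k - Λ k) * c k i - (lam k * c k i - Λ i * c k i)| := by
    rw [← abs_mul]; congr 1; ring
  rw [h4]
  refine (abs_sub _ _).trans ?_
  rw [abs_mul]
  have h5 : |lam k - Λ k| * |c k i| ≤ m * (m * δ) * 1 :=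
    mul_le_mul h1 h3 (abs_nonneg _) (by positivity)
  have h6 : m * δ ≤ m * (m * δ) := by
    have : 0 ≤ m * δ := by positivity
    nlinarith
  linarith

/-- A unit vector whose coordinates outside `J` are small is close to a unit vector supported on
`J`. -/
theorem exists_unit_supported (v : EuclideanSpace ℝ (Fin m)) (hv : ‖v‖ = 1) (J : Fin m → Prop)
    {k : Fin m} (hk : J k) {η : ℝ} (hη : 0 ≤ η) (h : ∀ i, ¬J i → |v i| ≤ η) :
    ∃ u : EuclideanSpace ℝ (Fin m), ‖u‖ = 1 ∧ (∀ i, ¬J i → u i = 0) ∧ ‖v - u‖ ≤ 2 * (m * η) := by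
  classical
  have hm : (1 : ℝ) ≤ m := by exact_mod_cast k.pos
  let P : EuclideanSpace ℝ (Fin m) := WithLp.toLp 2 fun i => if J i then v i else 0
  have hPJ : ∀ i, ¬J i → P i = 0 := fun i hi => by simp [P, hi]
  have hvP : ‖v - P‖ ≤ m * η := by
    refine abs_le_of_sq_le_sq' ?_ (by positivity) |>.2
    rw [EuclideanSpace.real_norm_sq_eq]
    calc ∑ i, (v - P) i ^ 2 ≤ ∑ _i : Fin m, η ^ 2 := by
          refine Finset.sum_le_sum fun i _ => ?_
          by_cases hi : J i
          · simp [P, hi]; positivity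
          · have := h i hi
            simp only [PiLp.sub_apply, P, hi, if_false, sub_zero]
            rw [← sq_abs (v i)]
            gcongr
      _ = m * η ^ 2 := by simp
      _ ≤ m * (m * η ^ 2) := le_mul_of_one_le_left (by positivity) hm
      _ = (m * η) ^ 2 := by ring
  by_cases hP : P = 0
  · refine ⟨EuclideanSpace.single k 1, by simp, fun i hi => ?_, ?_⟩
    · have : i ≠ k := fun hik => hi (hik ▸ hk)
      simp [this]
    · rw [hP, sub_zero, hv] at hvP
      calc ‖v - EuclideanSpace.single k 1‖ ≤ ‖v‖ + ‖EuclideanSpace.single k (1 : ℝ)‖ :=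
            norm_sub_le _ _
        _ = 2 * 1 := by rw [hv]; simp; norm_num
        _ ≤ _ := by gcongr
  · have hP0 : 0 < ‖P‖ := norm_pos_iff.2 hP
    refine ⟨‖P‖⁻¹ • P, by rw [norm_smul, norm_inv, norm_norm, inv_mul_cancel₀ hP0.ne'],
      fun i hi => by simp [hPJ i hi], ?_⟩
    have h1 : ‖P - ‖P‖⁻¹ • P‖ ≤ m * η := by
      have h2 : P - ‖P‖⁻¹ • P = (1 - ‖P‖⁻¹) • P := by module
      rw [h2, norm_smul, Real.norm_eq_abs, ← abs_of_pos hP0, ← abs_mul, abs_of_pos hP0, sub_mul,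
        inv_mul_cancel₀ hP0.ne', one_mul, ← hv, abs_sub_comm]
      exact (abs_norm_sub_norm_le v P).trans hvP
    calc ‖v - ‖P‖⁻¹ • P‖ = ‖(v - P) + (P - ‖P‖⁻¹ • P)‖ := by congr 1; abel
      _ ≤ ‖v - P‖ + ‖P - ‖P‖⁻¹ • P‖ := norm_add_le _ _
      _ ≤ 2 * (m * η) := by linarith

theorem exists_sign_of_supported {u : EuclideanSpace ℝ (Fin m)} (hu : ‖u‖ = 1) {k : Fin m}
    (h : ∀ i, i ≠ k → u i = 0) :
    ∃ s : ℝ, (s = 1 ∨ s = -1) ∧ u = s • EuclideanSpace.single k (1 : ℝ) := by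
  have hu' : u = u k • EuclideanSpace.single k (1 : ℝ) := by
    ext i
    by_cases hi : i = k
    · subst hi; simp
    · simp [hi, h i hi]
  refine ⟨u k, ?_, hu'⟩
  rw [hu', norm_smul, PiLp.norm_single, norm_one, mul_one, Real.norm_eq_abs] at hu
  exact eq_or_eq_neg_of_abs_eq hu

end Perturbation

/-! ### Rescaling -/

section Rescaling

variable {n : ℕ}

/-- A similarity of ratio `ε` pushes Lebesgue measure forward to its multiple by `ε^{-(n+1)}`. -/
theorem map_similarity (p : EuclideanSpace ℝ (Fin (n + 1))) {ε : ℝ} (hε : 0 < ε)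
    (R : EuclideanSpace ℝ (Fin (n + 1)) ≃ₗᵢ[ℝ] EuclideanSpace ℝ (Fin (n + 1))) :
    MeasurableEmbedding (fun Y => p + ε • R Y) ∧
      Measure.map (fun Y => p + ε • R Y) volume
        = ENNReal.ofReal (ε ^ (n + 1))⁻¹ • (volume : Measure (EuclideanSpace ℝ (Fin (n + 1)))) := by
  have e1 : MeasurableEmbedding R := R.toHomeomorph.measurableEmbedding
  have e2 : MeasurableEmbedding fun Y : EuclideanSpace ℝ (Fin (n + 1)) => ε • Y :=
    (Homeomorph.smulOfNeZero ε hε.ne').measurableEmbedding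
  have e3 : MeasurableEmbedding fun Y : EuclideanSpace ℝ (Fin (n + 1)) => p + Y :=
    (Homeomorph.addLeft p).measurableEmbedding
  refine ⟨e3.comp (e2.comp e1), ?_⟩
  have h1 : (fun Y => p + ε • R Y) = (fun Y => p + Y) ∘ (fun Y => ε • Y) ∘ R := rfl
  rw [h1, ← Measure.map_map e3.measurable (e2.comp e1).measurable,
    ← Measure.map_map e2.measurable e1.measurable, R.measurePreserving.map_eq,
    Measure.map_addHaar_smul volume hε.ne', Measure.map_smul, map_add_left_eq_self,
    finrank_euclideanSpace, Fintype.card_fin, abs_of_pos (by positivity)]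

theorem setIntegral_similarity {F : Type*} [NormedAddCommGroup F] [NormedSpace ℝ F]
    (p : EuclideanSpace ℝ (Fin (n + 1))) {ε : ℝ} (hε : 0 < ε)
    (R : EuclideanSpace ℝ (Fin (n + 1)) ≃ₗᵢ[ℝ] EuclideanSpace ℝ (Fin (n + 1)))
    {D D' : Set (EuclideanSpace ℝ (Fin (n + 1)))} (hD : ∀ Y, p + ε • R Y ∈ D ↔ Y ∈ D')
    (g : EuclideanSpace ℝ (Fin (n + 1)) → F) :
    ∫ X in D, g X = ε ^ (n + 1) • ∫ Y in D', g (p + ε • R Y) := by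
  obtain ⟨he, hm⟩ := map_similarity p hε R
  have h1 := he.setIntegral_map (μ := volume) g D
  have h2 : (fun Y => p + ε • R Y) ⁻¹' D = D' := Set.ext hD
  rw [hm, h2, Measure.restrict_smul, integral_smul_measure,
    ENNReal.toReal_ofReal (by positivity)] at h1
  rw [← h1, smul_smul, mul_inv_cancel₀ (by positivity), one_smul]

theorem vol_similarity (p : EuclideanSpace ℝ (Fin (n + 1))) {ε : ℝ} (hε : 0 < ε)
    (R : EuclideanSpace ℝ (Fin (n + 1)) ≃ₗᵢ[ℝ] EuclideanSpace ℝ (Fin (n + 1)))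
    {D D' : Set (EuclideanSpace ℝ (Fin (n + 1)))} (hD : ∀ Y, p + ε • R Y ∈ D ↔ Y ∈ D') :
    vol D = ε ^ (n + 1) * vol D' := by
  have := setIntegral_similarity p hε R hD fun _ => (1 : ℝ)
  simpa [vol, measureReal_def] using this

/-- The covariance matrix as an operator, which is the form in which its behaviour under isometries is
visible. -/
theorem mulVec_covMatrix {m : ℕ} {D : Set (EuclideanSpace ℝ (Fin m))}
    {x : EuclideanSpace ℝ (Fin m)} {r : ℝ} (hD : D ⊆ Metric.closedBall x r)
    (w : EuclideanSpace ℝ (Fin m)) :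
    covMatrix D *ᵥ w.ofLp
      = (∫ X in D, inner ℝ w (X - barycenter D) • (X - barycenter D)).ofLp := by
  ext i
  have hi : IntegrableOn
      (fun X => inner ℝ w (X - barycenter D) • (X - barycenter D)) D :=
    (Continuous.continuousOn (by fun_prop)).integrableOn_compact
      (isCompact_closedBall x r) |>.mono_set hD
  have h := (EuclideanSpace.proj i : EuclideanSpace ℝ (Fin m) →L[ℝ] ℝ).integral_comp_comm hi
  simp only [PiLp.proj_apply] at h
  rw [← h]
  simp only [Matrix.mulVec, dotProduct, covMatrix, Matrix.of_apply, ← integral_mul_const]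
  rw [← integral_finsetSum _ fun j _ => (Continuous.continuousOn (by fun_prop)).integrableOn_compact
      (isCompact_closedBall x r) |>.mono_set hD]
  refine integral_congr_ae (Eventually.of_forall fun X => ?_)
  simp only [PiLp.smul_apply, PiLp.sub_apply, smul_eq_mul, PiLp.inner_apply,
    RCLike.inner_apply, conj_trivial, Finset.sum_mul]
  exact Finset.sum_congr rfl fun j _ => by ring

/-- Under a similarity of ratio `ε`, eigenvectors are rotated and eigenvalues scale by `ε^{n+3}`: the
volume contributes `n + 1` factors and the two coordinates one each. -/
theorem isEigenDecomposition_similarity (p : EuclideanSpace ℝ (Fin (n + 1))) {ε : ℝ} (hε : 0 < ε)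
    (R : EuclideanSpace ℝ (Fin (n + 1)) ≃ₗᵢ[ℝ] EuclideanSpace ℝ (Fin (n + 1)))
    {D D' : Set (EuclideanSpace ℝ (Fin (n + 1)))} (hD : ∀ Y, p + ε • R Y ∈ D ↔ Y ∈ D')
    (hD' : D' ⊆ Metric.closedBall 0 1) (hv : vol D' ≠ 0) {lam : Fin (n + 1) → ℝ}
    {b : OrthonormalBasis (Fin (n + 1)) ℝ (EuclideanSpace ℝ (Fin (n + 1)))}
    (h : IsEigenDecomposition (covMatrix D) lam b) :
    IsEigenDecomposition (covMatrix D') (fun i => lam i / ε ^ (n + 3)) (b.map R.symm) := by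
  have hball : D ⊆ Metric.closedBall p ε := by
    intro X hX
    have h1 : X = p + ε • R (R.symm (ε⁻¹ • (X - p))) := by
      rw [R.apply_symm_apply, smul_smul, mul_inv_cancel₀ hε.ne', one_smul]; abel
    rw [h1, hD] at hX
    have h2 := mem_closedBall_zero_iff.1 (hD' hX)
    rw [LinearIsometryEquiv.norm_map, norm_smul, norm_inv, Real.norm_of_nonneg hε.le,
      inv_mul_le_one₀ hε] at h2
    exact mem_closedBall_iff_norm.2 h2
  have hint : IntegrableOn (fun Y : EuclideanSpace ℝ (Fin (n + 1)) => Y) D' :=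
    (continuous_id.continuousOn.integrableOn_compact (isCompact_closedBall 0 1)).mono_set hD'
  have hfin : volume D' ≠ ⊤ := ne_top_of_le_ne_top measure_closedBall_lt_top.ne (measure_mono hD')
  have hbar : barycenter D = p + ε • R (barycenter D') := by
    have hRint : ∫ Y in D', R Y = R (∫ Y in D', Y) :=
      R.toContinuousLinearEquiv.toContinuousLinearMap.integral_comp_comm hint
    have hRi : IntegrableOn (fun Y => R Y) D' :=
      (R.continuous.continuousOn.integrableOn_compact (isCompact_closedBall 0 1)).mono_set hD'
    have hpi : IntegrableOn (fun _ : EuclideanSpace ℝ (Fin (n + 1)) => p) D' :=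
      integrableOn_const hfin
    rw [barycenter, setIntegral_similarity p hε R hD, vol_similarity p hε R hD,
      integral_add (g := fun Y => ε • R Y) hpi (hRi.smul ε), setIntegral_const, integral_smul, hRint,
      smul_smul, barycenter, map_smul, show volume.real D' = vol D' from rfl, smul_add, smul_smul,
      smul_smul, smul_smul]
    congr 1
    · rw [show (ε ^ (n + 1) * vol D')⁻¹ * ε ^ (n + 1) * vol D' = 1 by field_simp, one_smul]
    · congr 1
      field_simp
  refine ⟨fun i j hij => div_le_div_of_nonneg_right (h.1 hij) (by positivity), fun i => ?_⟩
  have h1 := h.2 i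
  rw [mulVec_covMatrix hball, setIntegral_similarity p hε R hD, hbar] at h1
  have h2 : ∀ Y, inner ℝ (b i) (p + ε • R Y - (p + ε • R (barycenter D')))
        • (p + ε • R Y - (p + ε • R (barycenter D')))
      = ε ^ 2 • R (inner ℝ (R.symm (b i)) (Y - barycenter D') • (Y - barycenter D')) := by
    intro Y
    have h3 : p + ε • R Y - (p + ε • R (barycenter D')) = ε • R (Y - barycenter D') := by
      rw [map_sub]; module
    have h4 : inner ℝ (b i) (R (Y - barycenter D'))
        = inner ℝ (R.symm (b i)) (Y - barycenter D') := by
      conv_lhs => rw [← R.apply_symm_apply (b i), R.inner_map_map]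
    rw [h3, real_inner_smul_right, h4, map_smul, smul_smul, smul_smul]
    congr 1
    ring
  simp_rw [h2] at h1
  have hint2 : IntegrableOn
      (fun Y => inner ℝ (R.symm (b i)) (Y - barycenter D') • (Y - barycenter D')) D' :=
    (Continuous.continuousOn (by fun_prop)).integrableOn_compact
      (isCompact_closedBall 0 1) |>.mono_set hD'
  have h5 : ∫ Y in D', R (inner ℝ (R.symm (b i)) (Y - barycenter D') • (Y - barycenter D'))
      = R (∫ Y in D', inner ℝ (R.symm (b i)) (Y - barycenter D') • (Y - barycenter D')) :=
    R.toContinuousLinearEquiv.toContinuousLinearMap.integral_comp_comm hint2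
  rw [integral_smul, h5, smul_smul] at h1
  have h6 : _ = lam i • b i := WithLp.ofLp_injective 2 h1
  have h7 := congrArg R.symm h6
  rw [map_smul, map_smul, R.symm_apply_apply, ← pow_add] at h7
  rw [OrthonormalBasis.map_apply, mulVec_covMatrix hD', ← WithLp.ofLp_smul]
  congr 1
  change _ = (lam i / ε ^ (n + 3)) • R.symm (b i)
  rw [div_eq_inv_mul, mul_smul, ← h7, smul_smul, inv_mul_cancel₀ (by positivity), one_smul]

theorem ballVol_eq (m : ℕ) {ε : ℝ} (hε : 0 < ε) : ballVol m ε = ε ^ m * ballVol m 1 := by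
  have := Measure.addHaar_real_closedBall' (volume : Measure (EuclideanSpace ℝ (Fin m))) 0 hε.le
  rw [finrank_euclideanSpace, Fintype.card_fin] at this
  exact this

end Rescaling

/-! ### The curvature descriptors -/

section Descriptors

variable {n : ℕ} {κ : Fin n → ℝ} {ε : ℝ}

theorem meanCurvDescriptor_eq (hε : 0 < ε) (v : ℝ) :
    meanCurvDescriptor n ε (ε ^ (n + 1) * v)
      = (n + 2) / (ε * ballVol n 1) * (ballVol (n + 1) 1 - 2 * v) := by
  have hV := ballVol_one_pos n
  have hW := ballVol_one_pos (n + 1)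
  rw [meanCurvDescriptor, ballVol_eq n hε, ballVol_eq (n + 1) hε]
  field_simp
  ring

theorem abs_sub_meanCurvDescriptor_le (hε : 0 < ε) {v K : ℝ}
    (hv : |v - (ballVol (n + 1) 1 / 2 - ε * (ballVol n 1 / (2 * (n + 2)) * ∑ μ, κ μ))|
      ≤ K * ε ^ 2) :
    |(∑ μ, κ μ) - meanCurvDescriptor n ε (ε ^ (n + 1) * v)|
      ≤ 2 * (n + 2) * K / ballVol n 1 * ε := by
  have hV := ballVol_one_pos n
  rw [meanCurvDescriptor_eq hε]
  set r := v - (ballVol (n + 1) 1 / 2 - ε * (ballVol n 1 / (2 * (n + 2)) * ∑ μ, κ μ)) with hr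
  have h1 : (∑ μ, κ μ) - (n + 2) / (ε * ballVol n 1) * (ballVol (n + 1) 1 - 2 * v)
      = 2 * (n + 2) / (ε * ballVol n 1) * r := by
    rw [hr]
    field_simp
    ring
  rw [h1, abs_mul, abs_of_pos (by positivity)]
  calc _ ≤ 2 * (n + 2) / (ε * ballVol n 1) * (K * ε ^ 2) := by gcongr
    _ = _ := by field_simp

theorem limitDiag_castSucc (d : ℝ) (μ : Fin n) :
    limitDiag κ ε d μ.castSucc = ballVol (n + 1) 1 / (2 * (n + 3))
      - ε * (ballVol n 1 / (2 * (n + 2) * (n + 4)) * (∑ ν, κ ν + 2 * κ μ)) := by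
  rw [limitDiag, Fin.snoc_castSucc]

theorem limitDiag_last (d : ℝ) : limitDiag κ ε d (Fin.last n) = d := by
  rw [limitDiag, Fin.snoc_last]

/-- The combination of eigenvalues in the descriptor cancels both `W / (2 (n + 3))` and the mean
curvature, and leaves a multiple of `κ_μ`. -/
theorem abs_sub_curvDescriptor_le (hε : 0 < ε) {lam : Fin (n + 1) → ℝ} {d K : ℝ}
    (hlam : ∀ μ : Fin n, |lam μ.castSucc / ε ^ (n + 3) - limitDiag κ ε d μ.castSucc| ≤ K * ε ^ 2)
    (μ : Fin n) :
    |κ μ - curvDescriptor n ε lam μ| ≤ (n + 4) * (2 * n + 2) * K / ballVol n 1 * ε := by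
  have hV := ballVol_one_pos n
  obtain ⟨r, hr⟩ : ∃ r : Fin n → ℝ, ∀ ν,
      r ν = lam ν.castSucc / ε ^ (n + 3) - limitDiag κ ε d ν.castSucc := ⟨_, fun _ => rfl⟩
  simp_rw [← hr] at hlam
  have hlr : ∀ ν : Fin n, lam ν.castSucc = ε ^ (n + 3) * (r ν
      + (ballVol (n + 1) 1 / (2 * (n + 3))
      - ε * (ballVol n 1 / (2 * (n + 2) * (n + 4)) * (∑ α, κ α + 2 * κ ν)))) := by
    intro ν
    rw [← limitDiag_castSucc (κ := κ) d, hr]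
    field_simp
    ring
  have h1 : κ μ - curvDescriptor n ε lam μ
      = (n + 4) / (ε * ballVol n 1) * ((n + 2) * r μ - ∑ ν, r ν) := by
    rw [curvDescriptor, ballVol_eq n hε, ballVol_eq (n + 1) hε,
      Finset.sum_erase_eq_sub (Finset.mem_univ μ)]
    simp_rw [hlr]
    rw [← Finset.mul_sum, Finset.sum_add_distrib, Finset.sum_sub_distrib, ← Finset.mul_sum,
      ← Finset.mul_sum, Finset.sum_add_distrib, ← Finset.mul_sum]
    simp only [Finset.sum_const, Finset.card_univ, Fintype.card_fin, nsmul_eq_mul]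
    field_simp
    ring
  have h2 : |(n + 2) * r μ - ∑ ν, r ν| ≤ (2 * n + 2) * (K * ε ^ 2) := by
    have h3 : |∑ ν, r ν| ≤ n * (K * ε ^ 2) := by
      refine (Finset.abs_sum_le_sum_abs _ _).trans ((Finset.sum_le_sum fun ν _ => hlam ν).trans ?_)
      simp
    have h4 : |((n : ℝ) + 2) * r μ| ≤ (n + 2) * (K * ε ^ 2) := by
      rw [abs_mul, abs_of_pos (by positivity)]
      gcongr
      exact hlam μ
    linarith [abs_sub ((n + 2) * r μ) (∑ ν, r ν)]
  rw [h1, abs_mul, abs_of_pos (by positivity)]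
  calc _ ≤ (n + 4) / (ε * ballVol n 1) * ((2 * n + 2) * (K * ε ^ 2)) := by gcongr
    _ = _ := by field_simp

theorem abs_sub_curvDescriptorVol_le (hε : 0 < ε) {lam : Fin (n + 1) → ℝ} {d K v M : ℝ}
    (hlam : ∀ μ : Fin n, |lam μ.castSucc / ε ^ (n + 3) - limitDiag κ ε d μ.castSucc| ≤ K * ε ^ 2)
    (hM : |(∑ μ, κ μ) - meanCurvDescriptor n ε v| ≤ M * ε) (μ : Fin n) :
    |κ μ - curvDescriptorVol n ε v lam μ|
      ≤ ((n + 2) * (n + 4) * K / ballVol n 1 + M) * ε := by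
  have hV := ballVol_one_pos n
  set r := lam μ.castSucc / ε ^ (n + 3) - limitDiag κ ε d μ.castSucc with hr
  have hrK : |r| ≤ K * ε ^ 2 := hlam μ
  have hlr : lam μ.castSucc = ε ^ (n + 3) * (r
      + (ballVol (n + 1) 1 / (2 * (n + 3))
      - ε * (ballVol n 1 / (2 * (n + 2) * (n + 4)) * (∑ α, κ α + 2 * κ μ)))) := by
    rw [← limitDiag_castSucc (κ := κ) d, hr]
    field_simp
    ring
  have h1 : κ μ - curvDescriptorVol n ε v lam μ
      = (n + 2) * (n + 4) / (ε * ballVol n 1) * r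
        - 1 / 2 * ((∑ μ, κ μ) - meanCurvDescriptor n ε v) := by
    rw [curvDescriptorVol, ballVol_eq n hε, ballVol_eq (n + 1) hε, hlr]
    field_simp
    ring
  rw [h1]
  refine (abs_sub _ _).trans ?_
  rw [abs_mul, abs_mul, abs_of_pos (by positivity), abs_of_pos (by norm_num : (0 : ℝ) < 1 / 2)]
  have h2 : (n + 2) * (n + 4) / (ε * ballVol n 1) * |r|
      ≤ (n + 2) * (n + 4) * K / ballVol n 1 * ε := by
    calc _ ≤ (n + 2) * (n + 4) / (ε * ballVol n 1) * (K * ε ^ 2) := by gcongr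
      _ = _ := by field_simp
  have h3 := abs_nonneg ((∑ μ, κ μ) - meanCurvDescriptor n ε v)
  linarith

end Descriptors

section Eigenvectors

variable {n : ℕ} {κ : Fin n → ℝ} {ε d g : ℝ}

theorem le_limitDiag (hε : 0 < ε)
    (hεg : ε * (∑ μ, |ballVol n 1 / (2 * (n + 2) * (n + 4)) * (∑ ν, κ ν + 2 * κ μ)|) ≤ g / 2)
    (hd : d ≤ ballVol (n + 1) 1 / (2 * (n + 3)) - g) (μ : Fin n) :
    d + g / 2 ≤ limitDiag κ ε d μ.castSucc := by
  rw [limitDiag_castSucc]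
  set β : Fin n → ℝ := fun μ => ballVol n 1 / (2 * (n + 2) * (n + 4)) * (∑ ν, κ ν + 2 * κ μ)
    with hβ
  have h1 : β μ ≤ ∑ ν, |β ν| := (le_abs_self _).trans
    (Finset.single_le_sum (f := fun ν => |β ν|) (fun _ _ => abs_nonneg _) (Finset.mem_univ μ))
  have h2 : ε * β μ ≤ ε * ∑ ν, |β ν| := by gcongr
  change d + g / 2 ≤ ballVol (n + 1) 1 / (2 * (n + 3)) - ε * β μ
  linarith

theorem antitone_limitDiag (hκ : Monotone κ) (hε : 0 < ε) (hg : 0 < g)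
    (hgap : ∀ μ : Fin n, d + g / 2 ≤ limitDiag κ ε d μ.castSucc) : Antitone (limitDiag κ ε d) := by
  have hV := ballVol_one_pos n
  intro i j hij
  induction j using Fin.lastCases with
  | last =>
    induction i using Fin.lastCases with
    | last => exact le_rfl
    | cast μ => rw [limitDiag_last]; linarith [hgap μ]
  | cast ν =>
    induction i using Fin.lastCases with
    | last => exact absurd (Fin.castSucc_lt_last ν) hij.not_gt
    | cast μ =>
      rw [limitDiag_castSucc, limitDiag_castSucc]
      have := hκ (Fin.castSucc_le_castSucc_iff.1 hij)
      gcongr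

/-- Eigenvectors of a matrix that is `O(ε²)`-close to the limiting diagonal matrix: the gap between
tangential entries with different curvatures is of order `ε`, and the gap to the normal entry is of
order `1`. -/
theorem abs_eigenvector_apply_le (hε : 0 < ε) (hε1 : ε ≤ 1) (hg : 0 < g)
    {c : Fin (n + 1) → EuclideanSpace ℝ (Fin (n + 1))} {K : ℝ} (hK : 0 ≤ K)
    (hgap : ∀ μ : Fin n, d + g / 2 ≤ limitDiag κ ε d μ.castSucc)
    (h : ∀ i k, |limitDiag κ ε d i - limitDiag κ ε d k| * |c k i| ≤ K * ε ^ 2) :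
    (∀ (μ : Fin n) (i : Fin (n + 1)), (¬∃ ν : Fin n, i = ν.castSucc ∧ κ ν = κ μ) →
      |c μ.castSucc i| ≤ (2 * K / g + ∑ α, ∑ β, K / (ballVol n 1 / ((n + 2) * (n + 4))
        * |κ α - κ β|)) * ε) ∧
    ∀ i, i ≠ Fin.last n → |c (Fin.last n) i| ≤ 2 * K / g * ε ^ 2 := by
  have hV := ballVol_one_pos n
  have hfar : ∀ i k, g / 2 ≤ |limitDiag κ ε d i - limitDiag κ ε d k| →
      |c k i| ≤ 2 * K / g * ε ^ 2 := by
    intro i k hik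
    have h1 : g / 2 * |c k i| ≤ K * ε ^ 2 :=
      (mul_le_mul_of_nonneg_right hik (abs_nonneg _)).trans (h i k)
    rw [div_mul_eq_mul_div, le_div_iff₀ hg]
    linarith
  have hS0 : ∀ α β, 0 ≤ K / (ballVol n 1 / ((n + 2) * (n + 4)) * |κ α - κ β|) :=
    fun α β => by positivity
  constructor
  · intro μ i hi
    induction i using Fin.lastCases with
    | last =>
      have h1 := hfar (Fin.last n) μ.castSucc (by
        rw [limitDiag_last, abs_sub_comm]
        exact (by linarith [hgap μ] : g / 2 ≤ limitDiag κ ε d μ.castSucc - d).trans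
          (le_abs_self _))
      refine h1.trans ?_
      rw [add_mul]
      have h2 : 0 ≤ ∑ α, ∑ β, K / (ballVol n 1 / ((n + 2) * (n + 4)) * |κ α - κ β|) :=
        Finset.sum_nonneg fun α _ => Finset.sum_nonneg fun β _ => hS0 α β
      have h3 : 2 * K / g * ε ^ 2 ≤ 2 * K / g * ε := by gcongr; nlinarith
      have h4 := mul_nonneg h2 hε.le
      linarith
    | cast ν =>
      have hne : κ ν ≠ κ μ := fun hνμ => hi ⟨ν, rfl, hνμ⟩
      have hpos : 0 < |κ ν - κ μ| := abs_pos.2 (sub_ne_zero.2 hne)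
      have h1 := h ν.castSucc μ.castSucc
      have h2 : limitDiag κ ε d ν.castSucc - limitDiag κ ε d μ.castSucc
          = -(ε * (ballVol n 1 / ((n + 2) * (n + 4))) * (κ ν - κ μ)) := by
        rw [limitDiag_castSucc, limitDiag_castSucc]
        field_simp
        ring
      rw [h2, abs_neg, abs_mul, abs_of_pos (by positivity)] at h1
      have h3 : |c μ.castSucc ν.castSucc|
          ≤ K / (ballVol n 1 / ((n + 2) * (n + 4)) * |κ ν - κ μ|) * ε := by
        rw [div_mul_eq_mul_div, le_div_iff₀ (by positivity)]
        refine le_of_mul_le_mul_left ?_ hε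
        linarith
      refine h3.trans ?_
      gcongr
      have h4 : K / (ballVol n 1 / ((n + 2) * (n + 4)) * |κ ν - κ μ|)
          ≤ ∑ α, ∑ β, K / (ballVol n 1 / ((n + 2) * (n + 4)) * |κ α - κ β|) :=
        (Finset.single_le_sum (f := fun β => K / (ballVol n 1 / ((n + 2) * (n + 4)) * |κ ν - κ β|))
          (fun β _ => hS0 ν β) (Finset.mem_univ μ)).trans
        (Finset.single_le_sum
          (f := fun α => ∑ β, K / (ballVol n 1 / ((n + 2) * (n + 4)) * |κ α - κ β|))
          (fun α _ => Finset.sum_nonneg fun β _ => hS0 α β) (Finset.mem_univ ν))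
      have h5 : 0 ≤ 2 * K / g := by positivity
      linarith
  · intro i hi
    induction i using Fin.lastCases with
    | last => exact absurd rfl hi
    | cast ν =>
      refine hfar _ _ ?_
      rw [limitDiag_last]
      exact (by linarith [hgap ν] : g / 2 ≤ limitDiag κ ε d ν.castSucc - d).trans
        (le_abs_self _)

end Eigenvectors

end CurvatureDescriptors

open CurvatureDescriptors in
theorem mainTheorem6 (n : ℕ) (hn : 1 ≤ n)
    (S : Set (EuclideanSpace ℝ (Fin (n + 1))))
    (hS : CurvatureDescriptors.IsSmoothHypersurface S)
    (p : EuclideanSpace ℝ (Fin (n + 1))) (hp : p ∈ S)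
    (N : EuclideanSpace ℝ (Fin (n + 1)) → EuclideanSpace ℝ (Fin (n + 1)))
    (hN : CurvatureDescriptors.IsUnitNormalNear S N p)
    (κ : Fin n → ℝ) (e : Fin n → EuclideanSpace ℝ (Fin (n + 1)))
    (he : CurvatureDescriptors.IsPrincipalFrame S N p κ e) :
    ∃ C ε₀ : ℝ, 0 < ε₀ ∧ ∀ ε : ℝ, 0 < ε → ε < ε₀ →
      |(∑ μ, κ μ) - CurvatureDescriptors.meanCurvDescriptor n ε
          (CurvatureDescriptors.vol (CurvatureDescriptors.sphericalComponent S p (N p) ε))|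
        ≤ C * ε ∧
      ∀ (lam : Fin (n + 1) → ℝ)
        (b : OrthonormalBasis (Fin (n + 1)) ℝ (EuclideanSpace ℝ (Fin (n + 1)))),
        CurvatureDescriptors.IsEigenDecomposition
          (CurvatureDescriptors.covMatrix
            (CurvatureDescriptors.sphericalComponent S p (N p) ε)) lam b →
        (∀ μ, |κ μ - CurvatureDescriptors.curvDescriptor n ε lam μ| ≤ C * ε) ∧
        (∀ μ, |κ μ - CurvatureDescriptors.curvDescriptorVol n ε
          (CurvatureDescriptors.vol (CurvatureDescriptors.sphericalComponent S p (N p) ε)) lam μ|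
            ≤ C * ε) ∧
        (∀ μ : Fin n, ∃ u : EuclideanSpace ℝ (Fin (n + 1)), ‖u‖ = 1 ∧
          CurvatureDescriptors.IsPrincipalVector S N p (κ μ) u ∧
            ‖b μ.castSucc - u‖ ≤ C * ε) ∧
        (∀ μ : Fin n, (∀ ν, ν ≠ μ → κ ν ≠ κ μ) →
          ∃ s : ℝ, (s = 1 ∨ s = -1) ∧ ‖s • b μ.castSucc - e μ‖ ≤ C * ε) ∧
        (∃ s : ℝ, (s = 1 ∨ s = -1) ∧ ‖s • b (Fin.last n) - N p‖ ≤ C * ε ^ 2) := by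
  obtain ⟨B, hBe, hBN⟩ := exists_orthonormalBasis_of_isPrincipalFrame hp hN he
  obtain ⟨C, ε₁, hC, hε₁, hform⟩ := exists_sphericalComponent_normal_form hS hp hN he B hBe hBN
  obtain ⟨K, g, ε₂, hK, hg, hε₂, hcap⟩ := exists_covMatrix_cap hn κ hC
  have hV := ballVol_one_pos n
  have hW := ballVol_one_pos (n + 1)
  set T := ∑ μ, |ballVol n 1 / (2 * (n + 2) * (n + 4)) * (∑ ν, κ ν + 2 * κ μ)| with hT
  have hT0 : 0 ≤ T := Finset.sum_nonneg fun _ _ => abs_nonneg _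
  set P := ballVol n 1 / (2 * (n + 2)) * ∑ μ, κ μ with hP
  set K₁ := ((n + 1 : ℕ) : ℝ) * ((n + 1 : ℕ) * K) with hK₁
  have hK₁0 : 0 < K₁ := by positivity
  -- `Cη ε` bounds the components of `b μ` outside the eigenspace of `κ μ`; terms with
  -- `κ α = κ β` are `0` by the convention `x / 0 = 0`.
  set Cη := 2 * (2 * K₁) / g + ∑ α, ∑ β, 2 * K₁ / (ballVol n 1 / ((n + 2) * (n + 4))
    * |κ α - κ β|) with hCη
  have hCη0 : 0 ≤ Cη := add_nonneg (by positivity)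
    (Finset.sum_nonneg fun _ _ => Finset.sum_nonneg fun _ _ => by positivity)
  set C₁ := 2 * (n + 2) * K / ballVol n 1 with hC₁
  set C₂ := (n + 4) * (2 * n + 2) * K₁ / ballVol n 1 with hC₂
  set C₃ := (n + 2) * (n + 4) * K₁ / ballVol n 1 + C₁ with hC₃
  set C₄ := 2 * (((n + 1 : ℕ) : ℝ) * Cη) with hC₄
  set C₅ := 2 * (((n + 1 : ℕ) : ℝ) * (2 * (2 * K₁) / g)) with hC₅
  have h1 : 0 ≤ C₁ := by positivity
  have h2 : 0 ≤ C₂ := by positivity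
  have h3 : 0 ≤ C₃ := by positivity
  have h4 : 0 ≤ C₄ := by positivity
  have h5 : 0 ≤ C₅ := by positivity
  refine ⟨C₁ + C₂ + C₃ + C₄ + C₅, min (min ε₁ ε₂) (min 1 (min (g / (2 * T + 1))
    (ballVol (n + 1) 1 / (2 * (|P| + K))))), by positivity, fun ε hε hεlt => ?_⟩
  simp only [lt_min_iff] at hεlt
  obtain ⟨⟨hεε₁, hεε₂⟩, hε1, hεg, hεW⟩ := hεlt
  rw [lt_div_iff₀ (by positivity)] at hεg hεW
  have hεg' : ε * T ≤ g / 2 := by linarith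
  obtain ⟨D, hD, hmem⟩ := hform ε hε hεε₁
  obtain ⟨hvol, d, hd, hcov⟩ := hcap ε D hε hεε₂ hD
  have hv0 : vol D ≠ 0 := by
    have h6 := (abs_le.1 hvol).1
    have h7 : ε * P ≤ ε * |P| := by gcongr; exact le_abs_self P
    have h8 : K * ε ^ 2 ≤ K * ε := by gcongr; nlinarith
    intro h9
    rw [h9] at h6
    linarith
  have hgap := le_limitDiag hε hεg' hd
  have hanti := antitone_limitDiag he.1 hε hg hgap
  have hle : ∀ {x c t : ℝ}, x ≤ c * t → 0 ≤ t → c ≤ C₁ + C₂ + C₃ + C₄ + C₅ →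
      x ≤ (C₁ + C₂ + C₃ + C₄ + C₅) * t := fun hx ht hc =>
    hx.trans (mul_le_mul_of_nonneg_right hc ht)
  have hmean := abs_sub_meanCurvDescriptor_le hε hvol
  rw [← vol_similarity p hε B.repr.symm hmem] at hmean
  refine ⟨hle hmean hε.le (by linarith), fun lam b hb => ?_⟩
  have hb' := isEigenDecomposition_similarity p hε B.repr.symm hmem hD.subset hv0 hb
  set c := b.map B.repr.symm.symm with hc
  have hcb : ∀ k, b k = B.repr.symm (c k) := fun k => by simp [hc]
  have hlam : ∀ k, |lam k / ε ^ (n + 3) - limitDiag κ ε d k| ≤ K₁ * ε ^ 2 := by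
    intro k
    calc _ ≤ _ := abs_eigenvalue_sub_le hb' hanti hcov k
      _ = _ := by rw [hK₁]; ring
  have hvec : ∀ i k, |limitDiag κ ε d i - limitDiag κ ε d k| * |c k i| ≤ 2 * K₁ * ε ^ 2 := by
    intro i k
    calc _ ≤ _ := abs_sub_mul_abs_eigenvector_le hb' hanti hcov i k
      _ = _ := by rw [hK₁]; ring
  obtain ⟨hct, hcl⟩ := abs_eigenvector_apply_le hε hε1.le hg (by positivity : 0 ≤ 2 * K₁) hgap hvec
  have hu : ∀ μ : Fin n, ∃ u : EuclideanSpace ℝ (Fin (n + 1)), ‖u‖ = 1 ∧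
      (∀ i, (¬∃ ν : Fin n, i = ν.castSucc ∧ κ ν = κ μ) → u i = 0) ∧
      ‖b μ.castSucc - B.repr.symm u‖ ≤ C₄ * ε := by
    intro μ
    obtain ⟨u, hu1, huJ, hub⟩ := exists_unit_supported (c μ.castSucc) (c.norm_eq_one _)
      (fun i => ∃ ν : Fin n, i = ν.castSucc ∧ κ ν = κ μ) ⟨μ, rfl, rfl⟩
      (mul_nonneg hCη0 hε.le) (hct μ)
    refine ⟨u, hu1, huJ, ?_⟩
    rw [hcb, ← map_sub, LinearIsometryEquiv.norm_map]
    calc _ ≤ _ := hub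
      _ = _ := by rw [hC₄]; ring
  have hsign : ∀ {s : ℝ} {x y : EuclideanSpace ℝ (Fin (n + 1))}, (s = 1 ∨ s = -1) →
      ‖s • x - y‖ = ‖x - s • y‖ := by
    rintro s x y (rfl | rfl)
    · simp
    · rw [← norm_neg]; congr 1; module
  refine ⟨fun μ => hle (abs_sub_curvDescriptor_le hε (fun μ => hlam _) μ) hε.le (by linarith),
    fun μ => hle (abs_sub_curvDescriptorVol_le hε (fun μ => hlam _) hmean μ) hε.le (by linarith),
    fun μ => ?_, fun μ hμ => ?_, ?_⟩
  · obtain ⟨u, hu1, huJ, hub⟩ := hu μ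
    refine ⟨B.repr.symm u, by rw [LinearIsometryEquiv.norm_map, hu1], ?_,
      hle hub hε.le (by linarith)⟩
    have h6 : B.repr.symm u = ∑ i : Fin n, u i.castSucc • e i := by
      rw [← B.sum_repr_symm, Fin.sum_univ_castSucc, huJ (Fin.last n)]
      · simp [hBe]
      · rintro ⟨ν, hν, -⟩
        exact (Fin.castSucc_lt_last ν).ne' hν
    rw [h6]
    refine isPrincipalVector_sum hS hp he _ _ fun i hi => huJ _ ?_
    rintro ⟨ν, hν, hκ⟩
    exact hi (Fin.castSucc_injective n hν ▸ hκ)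
  · obtain ⟨u, hu1, huJ, hub⟩ := hu μ
    obtain ⟨s, hs, hus⟩ := exists_sign_of_supported hu1 (k := μ.castSucc) fun i hi => huJ i (by
      rintro ⟨ν, rfl, hκ⟩
      by_contra
      exact hμ ν (fun h => hi (by rw [h])) hκ)
    refine ⟨s, hs, hle ?_ hε.le (by linarith : C₄ ≤ _)⟩
    rw [hsign hs]
    rwa [hus, map_smul, B.repr_symm_single, hBe] at hub
  · obtain ⟨u, hu1, huJ, hub⟩ := exists_unit_supported (c (Fin.last n)) (c.norm_eq_one _)
      (fun i => i = Fin.last n) rfl (by positivity) hcl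
    obtain ⟨s, hs, hus⟩ := exists_sign_of_supported hu1 huJ
    refine ⟨s, hs, hle ?_ (sq_nonneg ε) (by linarith : C₅ ≤ _)⟩
    rw [hsign hs, hcb, ← hBN, ← B.repr_symm_single, ← map_smul, ← hus, ← map_sub,
      LinearIsometryEquiv.norm_map]
    calc _ ≤ _ := hub
      _ = _ := by rw [hC₅]; ring
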